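/- Let $p$ be fixed and consider the linear model $y=X\beta^0+\varepsilon$ with $n$ observations, where $\beta^0\in\mathbb{R}^p$, the rows $X_1,\dots,X_n$ of $X$ are the first $n$ terms of a sequence of i.i.d. centered square-integrable random vectors in $\mathbb{R}^p$ with positive definite covariance matrix $C$, the entries of $\varepsilon=(\varepsilon_1,\dots,\varepsilon_n)$ are the first $n$ terms of a sequence of i.i.d. centered random variables with variance $\sigma^2\in(0,\infty)$, and the sequences $(X_i)_i$ and $(\varepsilon_i)_i$ are independent. For $\lambda_1\ge\dots\ge\lambda_p\ge 0$ let $J_{\lambda}(\beta)=\sum_{i=1}^p\lambda_i|\beta|_{(i)}$ be the SLOPE norm, where $|\beta|_{(1)}\ge\dots\ge|\beta|_{(p)}$ are the absolute values of the coordinates of $\beta$ in decreasing order, and let $J'_{\lambda}(\beta^0;u)=\lim_{t\downarrow0}\big(J_\lambda(\beta^0+tu)-J_\lambda(\beta^0)\big)/t$ be its directional derivative. The SLOPE pattern of $u\in\mathbb{R}^p$ is the vector $\mathbf{patt}(u)\in\mathbb{Z}^p$ with $\mathbf{patt}(u)_i=\operatorname{rank}(|u_i|)\operatorname{sgn}(u_i)$,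 where, for $u_i\neq0$, $\operatorname{rank}(|u_i|)$ is the number of distinct nonzero values among $|u_1|,\dots,|u_p|$ that are at most $|u_i|$. Let $\lambda^n=(\lambda^n_1\ge\dots\ge\lambda^n_p\ge0)$ be penalty vectors with $\lambda^n/\sqrt n\to\lambda$ as $n\to\infty$. Let $$\hat\beta_n\in\operatorname*{argmin}_{\beta\in\mathbb{R}^p}\ \tfrac12\|y-X\beta\|_2^2+J_{\lambda^n}(\beta),\qquad \hat u_n=\sqrt n(\hat\beta_n-\beta^0),$$ and let $$\hat u=\operatorname*{argmin}_{u\in\mathbb{R}^p}\ \tfrac12u^{T}Cu-u^{T}W+J'_{\lambda}(\beta^0;u),\qquad W\sim\mathcal N(0,\sigma^2C).$$ Then for every SLOPE pattern $\mathfrak p$, that is, every $\mathfrak p$ in the image of $\mathbf{patt}$, $$\mathbb{P}[\mathbf{patt}(\hat u_n)=\mathfrak p]\ \longrightarrow\ \mathbb{P}[\mathbf{patt}(\hat u)=\mathfrak p]\qquad(n\to\infty).$$ -/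

import Mathlib

open MeasureTheory ProbabilityTheory Filter Topology
open scoped Matrix

noncomputable section

/-- The decreasing rearrangement `|β|_(1) ≥ |β|_(2) ≥ …` of the absolute values of the coordinates
of `β`, with positions counted from `0`. -/
def sortedAbs {p : ℕ} (β : EuclideanSpace ℝ (Fin p)) (i : Fin p) : ℝ :=
  |β (Tuple.sort (fun j => -|β j|) i)|

/-- The sorted L-one (SLOPE) norm `J_lam(β) = ∑ i, lam_i |β|_(i)`. -/
def slopeNorm {p : ℕ} (lam : Fin p → ℝ) (β : EuclideanSpace ℝ (Fin p)) : ℝ :=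
  ∑ i, lam i * sortedAbs β i

/-- The (one-sided) directional derivative of the SLOPE norm at `β₀` in direction `u`, i.e. the
limit of `(J_lam(β₀ + t u) - J_lam(β₀)) / t` as `t` decreases to `0`. -/
def slopeDirDeriv {p : ℕ} (lam : Fin p → ℝ) (β₀ u : EuclideanSpace ℝ (Fin p)) : ℝ :=
  derivWithin (fun t : ℝ => slopeNorm lam (β₀ + t • u)) (Set.Ioi 0) 0

/-- The SLOPE pattern `patt(u)_i = rank(|u_i|) sgn(u_i)`, where `rank(|u_i|)` is the rank of `|u_i|`
among the distinct nonzero values of `|u_1|, …, |u_p|` (the smallest one has rank `1`). -/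
def slopePattern {p : ℕ} (u : EuclideanSpace ℝ (Fin p)) (i : Fin p) : ℤ :=
  ((((Finset.univ.image fun j => |u j|).filter fun t => 0 < t ∧ t ≤ |u i|).card : ℕ) : ℤ)
    * (SignType.sign (u i) : ℤ)

/-- The set of all SLOPE patterns in dimension `p`. -/
def slopePatterns (p : ℕ) : Set (Fin p → ℤ) :=
  Set.range slopePattern

/-- The `n × p` design matrix whose rows are the first `n` regressors. -/
def designMatrix {p : ℕ} (n : ℕ) (x : ℕ → EuclideanSpace ℝ (Fin p)) :
    Matrix (Fin n) (Fin p) ℝ :=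
  Matrix.of fun i j => x i j

/-- The response vector `y = X β₀ + ε` of the linear model with `n` observations. -/
def response {p : ℕ} (n : ℕ) (x : ℕ → EuclideanSpace ℝ (Fin p)) (e : ℕ → ℝ)
    (β₀ : EuclideanSpace ℝ (Fin p)) : Fin n → ℝ :=
  designMatrix n x *ᵥ β₀.ofLp + fun i : Fin n => e i

/-- `β` is a least-squares SLOPE estimate: it minimizes `‖y - A β‖² / 2 + J_lam(β)`. -/
def IsSlopeEstimate {n p : ℕ} (A : Matrix (Fin n) (Fin p) ℝ) (y : Fin n → ℝ) (lam : Fin p → ℝ)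
    (β : EuclideanSpace ℝ (Fin p)) : Prop :=
  IsMinOn (fun b : EuclideanSpace ℝ (Fin p) =>
    1 / 2 * ‖WithLp.toLp 2 (y - A *ᵥ b.ofLp)‖ ^ 2 + slopeNorm lam b) Set.univ β

/-- The limiting objective `V(u) = uᵀ C u / 2 - uᵀ w + J'_lam(β₀; u)`. -/
def limitObjective {p : ℕ} (C : Matrix (Fin p) (Fin p) ℝ) (lam : Fin p → ℝ)
    (β₀ w u : EuclideanSpace ℝ (Fin p)) : ℝ :=
  1 / 2 * (u.ofLp ⬝ᵥ C *ᵥ u.ofLp) - u.ofLp ⬝ᵥ w.ofLp + slopeDirDeriv lam β₀ u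

end

/-! Convergence of $\hat u_n$ in distribution is not enough, because the pattern map is
discontinuous. The proof shows instead that, for almost every value of the Gaussian limit, the
pattern of the minimizer survives small perturbations of the whole problem.

The forms $x_i\pm x_j$ cut space into finitely many relatively open cones, indexed by `signVector`.
The pattern is constant on each cone, and the SLOPE norm and its directional derivative $f$ at
$\beta^0$ are additive there. Hence the set `criticalForms` of all $w$ whose limit problem is
critical at a point of a given cone is convex (`convex_criticalForms`). The frontier of a convex set
is Lebesgue null and $W$ has a density, so almost surely $W$ lies in the interior of such a set.

In the interior, strict complementarity holds: the subgradient $w-Cu$ can move by a fixed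
$\varepsilon$ in every direction orthogonal to the flat of $u$ (`exists_pos_inner_add_le`). Leaving
the flat then costs at least a linear amount, which beats small errors in $C$, $w$ and $\lambda$. So
minimizers of nearby problems stay in the flat, close to $u$, in the same cone
(`exists_pos_signVector_minimizer_eq`).

After rescaling, the estimator solves such a nearby problem: the Gram operator converges by the law
of large numbers, the score vector converges in distribution to $W$ by the central limit theorem,
and the step $t=1/\sqrt n$ tends to $0$. The portmanteau inequality for open sets gives the lower
bound on the probability of any set of patterns; applied to $\{\mathfrak p\}$ and to its complement
it gives the limit. -/

/-! ### Order statistics and the SLOPE norm -/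

lemma sortedAbs_eq_of_antitone {p : ℕ} {x : EuclideanSpace ℝ (Fin p)} {τ : Equiv.Perm (Fin p)}
    (h : Antitone fun i => |x (τ i)|) (i : Fin p) : sortedAbs x i = |x (τ i)| := by
  have h1 : Monotone ((fun j => -|x j|) ∘ τ) := fun a b hab => neg_le_neg (h hab)
  have h2 := congrFun (Tuple.comp_sort_eq_comp_iff_monotone.2 h1) i
  simpa [sortedAbs] using h2.symm

lemma sortedAbs_antitone {p : ℕ} (x : EuclideanSpace ℝ (Fin p)) : Antitone (sortedAbs x) := by
  intro i j hij
  have := Tuple.monotone_sort (fun j => -|x j|) hij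
  simpa [sortedAbs] using this

lemma slopeNorm_eq_of_antitone {p : ℕ} (lam : Fin p → ℝ) {x : EuclideanSpace ℝ (Fin p)}
    {τ : Equiv.Perm (Fin p)} (h : Antitone fun i => |x (τ i)|) :
    slopeNorm lam x = ∑ i, lam i * |x (τ i)| := by
  simp only [slopeNorm, sortedAbs_eq_of_antitone h]

lemma slopeNorm_smul {p : ℕ} (lam : Fin p → ℝ) {c : ℝ} (hc : 0 ≤ c)
    (x : EuclideanSpace ℝ (Fin p)) : slopeNorm lam (c • x) = c * slopeNorm lam x := by
  have h : Antitone fun i => |(c • x) (Tuple.sort (fun j => -|x j|) i)| := by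
    intro i j hij
    simpa [abs_mul, sortedAbs] using mul_le_mul_of_nonneg_left (sortedAbs_antitone x hij) (abs_nonneg c)
  rw [slopeNorm_eq_of_antitone lam h, slopeNorm, Finset.mul_sum]
  refine Finset.sum_congr rfl fun i _ => ?_
  simp [abs_mul, abs_of_nonneg hc, sortedAbs]
  ring

lemma slopeNorm_lam_smul {p : ℕ} (c : ℝ) (lam : Fin p → ℝ) (x : EuclideanSpace ℝ (Fin p)) :
    slopeNorm (c • lam) x = c * slopeNorm lam x := by
  simp [slopeNorm, Finset.mul_sum, mul_assoc]

lemma slopeNorm_lam_sub {p : ℕ} (lam lam' : Fin p → ℝ) (x : EuclideanSpace ℝ (Fin p)) :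
    slopeNorm (lam - lam') x = slopeNorm lam x - slopeNorm lam' x := by
  simp [slopeNorm, sub_mul]

/-- This is the rearrangement inequality. It makes the norm a maximum of weighted sums over
permutations, whence subadditivity. -/
lemma sum_mul_abs_perm_le_slopeNorm {p : ℕ} {lam : Fin p → ℝ} (hlam : Antitone lam)
    (x : EuclideanSpace ℝ (Fin p)) (τ : Equiv.Perm (Fin p)) :
    ∑ i, lam i * |x (τ i)| ≤ slopeNorm lam x := by
  have h : Monovary lam (sortedAbs x) := hlam.monovary (sortedAbs_antitone x)
  have := h.sum_mul_comp_perm_le_sum_mul (σ := τ.trans (Tuple.sort fun j => -|x j|).symm)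
  simpa [sortedAbs, slopeNorm] using this

lemma slopeNorm_add_le {p : ℕ} {lam : Fin p → ℝ} (hlam : Antitone lam) (hlam0 : ∀ i, 0 ≤ lam i)
    (x y : EuclideanSpace ℝ (Fin p)) :
    slopeNorm lam (x + y) ≤ slopeNorm lam x + slopeNorm lam y := by
  set τ := Tuple.sort fun j => -|(x + y) j| with hτ
  calc slopeNorm lam (x + y) = ∑ i, lam i * |(x + y) (τ i)| := rfl
    _ ≤ ∑ i, (lam i * |x (τ i)| + lam i * |y (τ i)|) := by
        refine Finset.sum_le_sum fun i _ => ?_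
        rw [← mul_add]
        exact mul_le_mul_of_nonneg_left (abs_add_le _ _) (hlam0 i)
    _ ≤ _ := by
        rw [Finset.sum_add_distrib]
        exact add_le_add (sum_mul_abs_perm_le_slopeNorm hlam x τ)
          (sum_mul_abs_perm_le_slopeNorm hlam y τ)

/-- Pigeonhole: $k+1$ indices carry the largest entries of $x$ and $p-k$ indices carry the entries
of $y$ from position $k$ on. Together these are $p+1$, so some index belongs to both families. -/
lemma sortedAbs_le_add_norm_sub {p : ℕ} (x y : EuclideanSpace ℝ (Fin p)) (k : Fin p) :
    sortedAbs x k ≤ sortedAbs y k + ‖x - y‖ := by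
  set a := Tuple.sort fun j => -|x j| with ha
  set b := Tuple.sort fun j => -|y j| with hb
  obtain ⟨m, hm⟩ : ∃ m, m ∈ (Finset.Iic k).map a.toEmbedding ∩ (Finset.Ici k).map b.toEmbedding := by
    by_contra! hne
    have hdisj : Disjoint ((Finset.Iic k).map a.toEmbedding) ((Finset.Ici k).map b.toEmbedding) := by
      rw [Finset.disjoint_left]
      exact fun m h1 h2 => hne m (Finset.mem_inter.2 ⟨h1, h2⟩)
    have hcard := Finset.card_le_univ
      ((Finset.Iic k).map a.toEmbedding ∪ (Finset.Ici k).map b.toEmbedding)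
    rw [Finset.card_union_of_disjoint hdisj, Finset.card_map, Finset.card_map, Fin.card_Iic,
      Fin.card_Ici, Fintype.card_fin] at hcard
    omega
  simp only [Finset.mem_inter, Finset.mem_map, Finset.mem_Iic, Finset.mem_Ici] at hm
  obtain ⟨⟨i, hi, rfl⟩, j, hj, hij⟩ := hm
  have h1 : sortedAbs x k ≤ |x (a i)| := sortedAbs_antitone x hi
  have h2 : |y (a i)| ≤ sortedAbs y k := by
    have : |y (b j)| ≤ sortedAbs y k := sortedAbs_antitone y hj
    simp only [Equiv.coe_toEmbedding] at hij
    rwa [hij] at this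
  have h3 : |x (a i) - y (a i)| ≤ ‖x - y‖ := by
    simpa using PiLp.norm_apply_le (x - y) (a i)
  have h4 := abs_sub_abs_le_abs_sub (x (a i)) (y (a i))
  linarith

/-- The weights may have any sign and order, so that the bound applies to a difference of two
penalty vectors. -/
lemma abs_slopeNorm_sub_le {p : ℕ} (d : Fin p → ℝ) (x y : EuclideanSpace ℝ (Fin p)) :
    |slopeNorm d x - slopeNorm d y| ≤ p * ‖d‖ * ‖x - y‖ := by
  have h : ∀ k, |sortedAbs x k - sortedAbs y k| ≤ ‖x - y‖ := fun k => by
    have h1 := sortedAbs_le_add_norm_sub x y k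
    have h2 := sortedAbs_le_add_norm_sub y x k
    rw [norm_sub_rev] at h2
    exact abs_sub_le_iff.2 ⟨by linarith, by linarith⟩
  calc |slopeNorm d x - slopeNorm d y| = |∑ k, d k * (sortedAbs x k - sortedAbs y k)| := by
        simp [slopeNorm, mul_sub]
    _ ≤ ∑ k, |d k * (sortedAbs x k - sortedAbs y k)| := Finset.abs_sum_le_sum_abs _ _
    _ ≤ ∑ _k : Fin p, ‖d‖ * ‖x - y‖ := by
        refine Finset.sum_le_sum fun k _ => ?_
        rw [abs_mul]
        exact mul_le_mul (norm_le_pi_norm d k) (h k) (abs_nonneg _) (norm_nonneg _)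
    _ = _ := by simp [mul_assoc]

/-! ### The hyperplane arrangement of type B -/

/-- The linear forms `x i + x j` and `x i - x j`. The SLOPE norm is linear on every closed cone on
which none of them changes its sign. -/
noncomputable def rootForm {p : ℕ} (k : Fin p × Fin p × Bool) : EuclideanSpace ℝ (Fin p) →L[ℝ] ℝ :=
  EuclideanSpace.proj k.1 + (if k.2.2 then 1 else -1 : ℝ) • EuclideanSpace.proj k.2.1

lemma rootForm_true {p : ℕ} (i j : Fin p) (x : EuclideanSpace ℝ (Fin p)) :
    rootForm (i, j, true) x = x i + x j := by simp [rootForm]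

lemma rootForm_false {p : ℕ} (i j : Fin p) (x : EuclideanSpace ℝ (Fin p)) :
    rootForm (i, j, false) x = x i - x j := by simp [rootForm, sub_eq_add_neg]

/-- No root form strictly separates `x` from `y`. -/
def ShareChamber {p : ℕ} (x y : EuclideanSpace ℝ (Fin p)) : Prop :=
  ∀ k, 0 ≤ rootForm k x * rootForm k y

/-- The signs of all root forms at `x`. -/
noncomputable def signVector {p : ℕ} (x : EuclideanSpace ℝ (Fin p)) :
    Fin p × Fin p × Bool → SignType :=
  fun k => SignType.sign (rootForm k x)

lemma ShareChamber.smul {p : ℕ} {x y : EuclideanSpace ℝ (Fin p)} (h : ShareChamber x y) {a b : ℝ}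
    (ha : 0 ≤ a) (hb : 0 ≤ b) : ShareChamber (a • x) (b • y) := by
  intro k
  have := mul_nonneg (mul_nonneg ha hb) (h k)
  simp only [map_smul, smul_eq_mul]
  linarith

/-- The coordinates of $x$ and $y$ have compatible signs, so absolute values add. The product of the
forms $x_i+x_j$ and $x_i-x_j$ is $x_i^2-x_j^2$, so the absolute values are ordered compatibly as
well. Hence the permutation that sorts $x+y$ sorts both summands. -/
lemma slopeNorm_add_of_shareChamber {p : ℕ} (lam : Fin p → ℝ) {x y : EuclideanSpace ℝ (Fin p)}
    (h : ShareChamber x y) : slopeNorm lam (x + y) = slopeNorm lam x + slopeNorm lam y := by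
  have habs : ∀ i, |(x + y) i| = |x i| + |y i| := fun i => by
    have := h (i, i, true)
    rw [rootForm_true, rootForm_true] at this
    have h' : 0 ≤ x i * y i := by nlinarith
    rw [PiLp.add_apply, abs_add_eq_add_abs_iff]
    exact mul_nonneg_iff.1 h'
  have hsq : ∀ i j, 0 ≤ (|x i| - |x j|) * (|y i| - |y j|) := fun i j => by
    have h1 := h (i, j, true)
    have h2 := h (i, j, false)
    rw [rootForm_true, rootForm_true] at h1
    rw [rootForm_false, rootForm_false] at h2
    have h3 : 0 ≤ (x i ^ 2 - x j ^ 2) * (y i ^ 2 - y j ^ 2) := by nlinarith [mul_nonneg h1 h2]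
    by_contra! hlt
    have key : ∀ u v : ℝ, |u| < |v| → u ^ 2 < v ^ 2 := fun u v huv => sq_lt_sq.2 huv
    rcases mul_neg_iff.1 hlt with ⟨hx, hy⟩ | ⟨hx, hy⟩
    · have := key _ _ (sub_pos.1 hx)
      have := key _ _ (sub_neg.1 hy)
      nlinarith
    · have := key _ _ (sub_neg.1 hx)
      have := key _ _ (sub_pos.1 hy)
      nlinarith
  set τ := Tuple.sort fun j => -|(x + y) j| with hτ
  have hanti : Antitone fun i => |(x + y) (τ i)| := sortedAbs_antitone (x + y)
  have hmono : ∀ i j, i ≤ j → |x (τ j)| ≤ |x (τ i)| ∧ |y (τ j)| ≤ |y (τ i)| := fun i j hij => by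
    have h1 : |(x + y) (τ j)| ≤ |(x + y) (τ i)| := hanti hij
    have h2 := hsq (τ i) (τ j)
    rw [habs, habs] at h1
    constructor <;> by_contra! hlt <;> nlinarith
  rw [slopeNorm_eq_of_antitone lam hanti, slopeNorm_eq_of_antitone lam (fun i j hij => (hmono i j hij).1),
    slopeNorm_eq_of_antitone lam (fun i j hij => (hmono i j hij).2), ← Finset.sum_add_distrib]
  simp only [habs, mul_add]

/-- The form $x_i+x_i$ gives the sign of $x_i$, and the product $(x_i+x_j)(x_i-x_j)$ gives the order
of $|x_i|$ and $|x_j|$. Ranks depend on nothing else. -/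
lemma slopePattern_eq_of_signVector_eq {p : ℕ} {x y : EuclideanSpace ℝ (Fin p)}
    (h : signVector x = signVector y) : slopePattern x = slopePattern y := by
  have hadd : ∀ i j, SignType.sign (x i + x j) = SignType.sign (y i + y j) := fun i j => by
    simpa [signVector, rootForm_true] using congrFun h (i, j, true)
  have hsub : ∀ i j, SignType.sign (x i - x j) = SignType.sign (y i - y j) := fun i j => by
    simpa [signVector, rootForm_false] using congrFun h (i, j, false)
  have hsign : ∀ i, SignType.sign (x i) = SignType.sign (y i) := fun i => by
    have := hadd i i
    rw [← two_mul, ← two_mul, sign_mul, sign_mul] at this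
    simpa using this
  have hle : ∀ i j, |x i| ≤ |x j| ↔ |y i| ≤ |y j| := fun i j => by
    have key : ∀ u : EuclideanSpace ℝ (Fin p),
        |u i| ≤ |u j| ↔ SignType.sign ((u i + u j) * (u i - u j)) ≤ 0 := fun u => by
      rw [← sq_le_sq, sign_nonpos_iff]
      constructor <;> intro h <;> nlinarith
    rw [key, key, sign_mul, sign_mul, hadd, hsub]
  have hpos : ∀ i, 0 < |x i| ↔ 0 < |y i| := fun i => by
    rw [abs_pos, abs_pos, ← sign_ne_zero, hsign, sign_ne_zero]
  have himage : ∀ (u : EuclideanSpace ℝ (Fin p)) (i : Fin p),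
      ((Finset.univ.image fun j => |u j|).filter fun t => 0 < t ∧ t ≤ |u i|) =
        (Finset.univ.filter fun j => 0 < |u j| ∧ |u j| ≤ |u i|).image fun j => |u j| := by
    intro u i
    rw [Finset.filter_image]
  have hcard : ∀ (u v : EuclideanSpace ℝ (Fin p)) (s : Finset (Fin p)),
      (∀ i j, |u i| ≤ |u j| ↔ |v i| ≤ |v j|) →
      (s.image fun j => |v j|).card ≤ (s.image fun j => |u j|).card := by
    intro u v s huv
    refine Finset.card_le_card_of_surjOn
      (Function.extend (fun j => |u j|) (fun j => |v j|) 0) ?_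
    intro t ht
    obtain ⟨j, hj, rfl⟩ := Finset.mem_image.1 (Finset.mem_coe.1 ht)
    refine ⟨|u j|, Finset.mem_coe.2 (Finset.mem_image_of_mem _ hj), ?_⟩
    have hf : Function.FactorsThrough (fun j => |v j|) (fun j => |u j|) := fun a b hab =>
      le_antisymm ((huv a b).1 hab.le) ((huv b a).1 hab.ge)
    exact hf.extend_apply 0 j
  funext i
  simp only [slopePattern]
  rw [hsign i, himage, himage]
  congr 2
  have hfilter : (Finset.univ.filter fun j => 0 < |x j| ∧ |x j| ≤ |x i|) =
      Finset.univ.filter fun j => 0 < |y j| ∧ |y j| ≤ |y i| := by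
    ext j
    simp only [Finset.mem_filter, Finset.mem_univ, true_and, hpos j, hle j i]
  rw [hfilter]
  exact le_antisymm (hcard y x _ fun a b => (hle a b).symm) (hcard x y _ hle)

/-! ### The directional derivative of the SLOPE norm -/

lemma exists_pos_shareChamber {p : ℕ} (β₀ : EuclideanSpace ℝ (Fin p)) :
    ∃ ρ > 0, ∀ v : EuclideanSpace ℝ (Fin p), ‖v‖ < ρ → ShareChamber β₀ (β₀ + v) := by
  have h : ∀ᶠ x in 𝓝 β₀, ShareChamber β₀ x := by
    refine eventually_all.2 fun k => ?_
    rcases eq_or_ne (rootForm k β₀) 0 with h0 | h0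
    · exact Eventually.of_forall fun x => by simp [h0]
    · have hc : ContinuousAt (fun x => rootForm k β₀ * rootForm k x) β₀ := by fun_prop
      exact (hc.eventually (lt_mem_nhds (mul_self_pos.2 h0))).mono fun x hx => hx.le
  obtain ⟨ρ, hρ, hball⟩ := Metric.eventually_nhds_iff.1 h
  exact ⟨ρ, hρ, fun v hv => hball (by simpa using hv)⟩

/-- The endpoints of a short segment from $\beta^0$ share a chamber, so the norm is affine on the
segment. The one-sided derivative therefore exists, is not the default value of `derivWithin`, and
gives an expansion without remainder. -/
lemma slopeNorm_add_smul {p : ℕ} {β₀ : EuclideanSpace ℝ (Fin p)} {ρ : ℝ}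
    (hρ : ∀ v : EuclideanSpace ℝ (Fin p), ‖v‖ < ρ → ShareChamber β₀ (β₀ + v))
    (lam : Fin p → ℝ) (u : EuclideanSpace ℝ (Fin p)) {t : ℝ} (ht : 0 < t) (htu : t * ‖u‖ < ρ) :
    slopeNorm lam (β₀ + t • u) = slopeNorm lam β₀ + t * slopeDirDeriv lam β₀ u := by
  set c := t⁻¹ * (slopeNorm lam (β₀ + t • u) - slopeNorm lam β₀) with hc
  have hseg : ∀ s, 0 ≤ s → s ≤ t → slopeNorm lam (β₀ + s • u) = slopeNorm lam β₀ + s * c := by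
    intro s hs hst
    have hcomb : β₀ + s • u = (1 - s / t) • β₀ + (s / t) • (β₀ + t • u) := by
      rw [smul_add, smul_smul, div_mul_cancel₀ _ ht.ne', sub_smul, one_smul]
      abel
    have hchamber := hρ (t • u) (by rwa [norm_smul, Real.norm_of_nonneg ht.le])
    have h1 : 0 ≤ 1 - s / t := sub_nonneg.2 ((div_le_one ht).2 hst)
    have h2 : 0 ≤ s / t := div_nonneg hs ht.le
    rw [hcomb, slopeNorm_add_of_shareChamber lam (hchamber.smul h1 h2), slopeNorm_smul lam h1,
      slopeNorm_smul lam h2, hc]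
    field_simp
    ring
  have hderiv : slopeDirDeriv lam β₀ u = c := by
    have h1 : HasDerivWithinAt (fun s : ℝ => slopeNorm lam β₀ + s * c) c (Set.Ioi 0) 0 := by
      simpa using (((hasDerivAt_id (0 : ℝ)).mul_const c).const_add
        (slopeNorm lam β₀)).hasDerivWithinAt
    have h2 : (fun s : ℝ => slopeNorm lam (β₀ + s • u)) =ᶠ[𝓝[>] 0]
        fun s => slopeNorm lam β₀ + s * c := by
      filter_upwards [Ioo_mem_nhdsGT ht] with s hs using hseg s hs.1.le hs.2.le
    exact (h1.congr_of_eventuallyEq h2 (hseg 0 le_rfl ht.le)).derivWithin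
      (uniqueDiffWithinAt_Ioi 0)
  rw [hderiv]
  exact hseg t ht.le le_rfl

lemma exists_pos_mul_norm_lt {E ι : Type*} [Finite ι] [SeminormedAddCommGroup E] {ρ : ℝ}
    (hρ : 0 < ρ) (u : ι → E) : ∃ t : ℝ, 0 < t ∧ ∀ i, t * ‖u i‖ < ρ := by
  have h : ∀ᶠ t in 𝓝[>] (0 : ℝ), ∀ i, t * ‖u i‖ < ρ := by
    refine eventually_all.2 fun i => ?_
    have hc : Tendsto (fun t : ℝ => t * ‖u i‖) (𝓝[>] 0) (𝓝 0) := by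
      have : Tendsto (fun t : ℝ => t * ‖u i‖) (𝓝 0) (𝓝 (0 * ‖u i‖)) :=
        (continuous_id.mul continuous_const).tendsto 0
      rw [zero_mul] at this
      exact this.mono_left nhdsWithin_le_nhds
    exact hc.eventually (gt_mem_nhds hρ)
  obtain ⟨t, ht, ht0⟩ := (h.and self_mem_nhdsWithin).exists
  exact ⟨t, ht0, ht⟩

lemma slopeDirDeriv_smul {p : ℕ} (lam : Fin p → ℝ) (β₀ u : EuclideanSpace ℝ (Fin p)) {c : ℝ}
    (hc : 0 ≤ c) : slopeDirDeriv lam β₀ (c • u) = c * slopeDirDeriv lam β₀ u := by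
  obtain ⟨ρ, hρ0, hρ⟩ := exists_pos_shareChamber β₀
  rcases hc.eq_or_lt with rfl | hc
  · simp [slopeDirDeriv]
  obtain ⟨t, ht, h⟩ := exists_pos_mul_norm_lt hρ0 ![u, c • u]
  have h1 := slopeNorm_add_smul hρ lam (c • u) ht (h 1)
  have h2 := slopeNorm_add_smul hρ lam u (t := t * c) (by positivity) (by
    have := h 1
    simp only [Matrix.cons_val_one, Matrix.cons_val_fin_one, norm_smul, Real.norm_of_nonneg hc.le] at this
    linarith)
  rw [smul_smul, h2] at h1
  have : t * (c * slopeDirDeriv lam β₀ u) = t * slopeDirDeriv lam β₀ (c • u) := by linarith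
  exact (mul_left_cancel₀ ht.ne' this).symm

lemma slopeDirDeriv_add_le {p : ℕ} {lam : Fin p → ℝ} (hlam : Antitone lam)
    (hlam0 : ∀ i, 0 ≤ lam i) (β₀ u v : EuclideanSpace ℝ (Fin p)) :
    slopeDirDeriv lam β₀ (u + v) ≤ slopeDirDeriv lam β₀ u + slopeDirDeriv lam β₀ v := by
  obtain ⟨ρ, hρ0, hρ⟩ := exists_pos_shareChamber β₀
  obtain ⟨t, ht, h⟩ := exists_pos_mul_norm_lt hρ0
    ![(2 : ℝ) • u, (2 : ℝ) • v, u + v]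
  have h1 := slopeNorm_add_smul hρ lam _ ht (h 0)
  have h2 := slopeNorm_add_smul hρ lam _ ht (h 1)
  have h3 := slopeNorm_add_smul hρ lam _ ht (h 2)
  simp only [Matrix.cons_val] at h1 h2 h3
  have hmid : β₀ + t • (u + v) =
      (1 / 2 : ℝ) • ((β₀ + t • (2 : ℝ) • u) + (β₀ + t • (2 : ℝ) • v)) := by
    module
  rw [hmid, slopeNorm_smul lam (by norm_num)] at h3
  have h4 := slopeNorm_add_le hlam hlam0 (β₀ + t • (2 : ℝ) • u) (β₀ + t • (2 : ℝ) • v)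
  rw [slopeDirDeriv_smul _ _ _ zero_le_two] at h1 h2
  have : t * slopeDirDeriv lam β₀ (u + v) ≤
      t * (slopeDirDeriv lam β₀ u + slopeDirDeriv lam β₀ v) := by linarith
  exact le_of_mul_le_mul_left this ht

/-- For small $t>0$ the points $\beta^0+2tu$ and $\beta^0+2tv$ share a chamber: a form that is
nonzero at $\beta^0$ keeps its sign, and one that vanishes there takes the common sign of its values
at $u$ and $v$. The norm is then additive at their midpoint. -/
lemma slopeDirDeriv_add_of_signVector_eq {p : ℕ} (lam : Fin p → ℝ)
    (β₀ : EuclideanSpace ℝ (Fin p)) {u v : EuclideanSpace ℝ (Fin p)}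
    (huv : signVector u = signVector v) :
    slopeDirDeriv lam β₀ (u + v) = slopeDirDeriv lam β₀ u + slopeDirDeriv lam β₀ v := by
  obtain ⟨ρ, hρ0, hρ⟩ := exists_pos_shareChamber β₀
  have hch : ∀ᶠ t in 𝓝[>] (0 : ℝ), ShareChamber (β₀ + t • (2 : ℝ) • u) (β₀ + t • (2 : ℝ) • v) := by
    refine eventually_all.2 fun k => ?_
    have hk : 0 ≤ rootForm k u * rootForm k v := by
      rw [← sign_nonneg_iff, sign_mul]
      have : SignType.sign (rootForm k u) = SignType.sign (rootForm k v) := congrFun huv k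
      rw [this, ← sign_mul, sign_nonneg_iff]
      exact mul_self_nonneg _
    rcases eq_or_ne (rootForm k β₀) 0 with h0 | h0
    · refine Eventually.of_forall fun t => ?_
      simp only [map_add, map_smul, h0, zero_add, smul_eq_mul]
      nlinarith [mul_nonneg (mul_self_nonneg t) hk]
    · have hc : ContinuousAt (fun t : ℝ => rootForm k (β₀ + t • (2 : ℝ) • u) *
          rootForm k (β₀ + t • (2 : ℝ) • v)) 0 := by fun_prop
      have hpos : 0 < rootForm k (β₀ + (0 : ℝ) • (2 : ℝ) • u) *
          rootForm k (β₀ + (0 : ℝ) • (2 : ℝ) • v) := by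
        simpa using h0
      exact ((hc.eventually (lt_mem_nhds hpos)).filter_mono nhdsWithin_le_nhds).mono
        fun x hx => hx.le
  have hsmall : ∀ᶠ t in 𝓝[>] (0 : ℝ), ∀ i, t * ‖(![(2 : ℝ) • u, (2 : ℝ) • v, u + v] : Fin 3 → _) i‖ < ρ := by
    obtain ⟨t, ht, h⟩ := exists_pos_mul_norm_lt hρ0 ![(2 : ℝ) • u, (2 : ℝ) • v, u + v]
    filter_upwards [Ioo_mem_nhdsGT ht] with s hs i
    exact (mul_le_mul_of_nonneg_right hs.2.le (norm_nonneg _)).trans_lt (h i)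
  obtain ⟨t, ⟨hcht, h⟩, ht⟩ := ((hch.and hsmall).and self_mem_nhdsWithin).exists
  replace ht : 0 < t := ht
  have h1 := slopeNorm_add_smul hρ lam _ ht (h 0)
  have h2 := slopeNorm_add_smul hρ lam _ ht (h 1)
  have h3 := slopeNorm_add_smul hρ lam _ ht (h 2)
  simp only [Matrix.cons_val] at h1 h2 h3
  have hmid : β₀ + t • (u + v) =
      (1 / 2 : ℝ) • ((β₀ + t • (2 : ℝ) • u) + (β₀ + t • (2 : ℝ) • v)) := by
    module
  rw [hmid, slopeNorm_smul lam (by norm_num), slopeNorm_add_of_shareChamber lam hcht] at h3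
  rw [slopeDirDeriv_smul _ _ _ zero_le_two] at h1 h2
  have : t * slopeDirDeriv lam β₀ (u + v) =
      t * (slopeDirDeriv lam β₀ u + slopeDirDeriv lam β₀ v) := by linarith
  exact mul_left_cancel₀ ht.ne' this

lemma abs_slopeDirDeriv_sub_le {p : ℕ} (lam lam' : Fin p → ℝ) (β₀ u v : EuclideanSpace ℝ (Fin p)) :
    |(slopeDirDeriv lam' β₀ u - slopeDirDeriv lam' β₀ v) -
      (slopeDirDeriv lam β₀ u - slopeDirDeriv lam β₀ v)| ≤ p * ‖lam' - lam‖ * ‖u - v‖ := by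
  obtain ⟨ρ, hρ0, hρ⟩ := exists_pos_shareChamber β₀
  obtain ⟨t, ht, h⟩ := exists_pos_mul_norm_lt hρ0 ![u, v]
  have h1 := slopeNorm_add_smul hρ lam u ht (h 0)
  have h2 := slopeNorm_add_smul hρ lam v ht (h 1)
  have h3 := slopeNorm_add_smul hρ lam' u ht (h 0)
  have h4 := slopeNorm_add_smul hρ lam' v ht (h 1)
  have h5 := abs_slopeNorm_sub_le (lam' - lam) (β₀ + t • u) (β₀ + t • v)
  rw [slopeNorm_lam_sub, slopeNorm_lam_sub, h1, h2, h3, h4, add_sub_add_left_eq_sub, ← smul_sub,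
    norm_smul, Real.norm_of_nonneg ht.le] at h5
  refine le_of_mul_le_mul_left ?_ ht
  calc t * |(slopeDirDeriv lam' β₀ u - slopeDirDeriv lam' β₀ v) -
        (slopeDirDeriv lam β₀ u - slopeDirDeriv lam β₀ v)| = |t * ((slopeDirDeriv lam' β₀ u -
        slopeDirDeriv lam' β₀ v) - (slopeDirDeriv lam β₀ u - slopeDirDeriv lam β₀ v))| := by
        rw [abs_mul, abs_of_pos ht]
    _ ≤ _ := by
        convert h5 using 1
        · congr 1; ring
        · ring

/-! ### Subgradients of sublinear functions and strata of the arrangement -/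

/-- For a sublinear function `f`, the vector `r` is a subgradient of `f` at `u`. -/
def IsSublinearSubgradient {p : ℕ} (f : EuclideanSpace ℝ (Fin p) → ℝ)
    (u r : EuclideanSpace ℝ (Fin p)) : Prop :=
  (∀ v, inner ℝ r v ≤ f v) ∧ inner ℝ r u = f u

/-- The linear forms `w` for which `⟪C u, u⟫ / 2 - ⟪w, u⟫ + f u` is critical at a point with the
sign vector `s`. -/
def criticalForms {p : ℕ} (C : EuclideanSpace ℝ (Fin p) →L[ℝ] EuclideanSpace ℝ (Fin p))
    (f : EuclideanSpace ℝ (Fin p) → ℝ) (s : Fin p × Fin p × Bool → SignType) :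
    Set (EuclideanSpace ℝ (Fin p)) :=
  {w | ∃ u, signVector u = s ∧ IsSublinearSubgradient f u (w - C u)}

/-- The smallest flat of the arrangement that contains `u`. -/
def rootFlat {p : ℕ} (u : EuclideanSpace ℝ (Fin p)) : Submodule ℝ (EuclideanSpace ℝ (Fin p)) where
  carrier := {v | ∀ k, rootForm k u = 0 → rootForm k v = 0}
  add_mem' := fun ha hb k hk => by simp [ha k hk, hb k hk]
  zero_mem' := fun k _ => by simp
  smul_mem' := fun c x hx k hk => by simp [hx k hk]

lemma mem_rootFlat_of_signVector_eq {p : ℕ} {u v : EuclideanSpace ℝ (Fin p)}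
    (h : signVector v = signVector u) : v ∈ rootFlat u := by
  intro k hk
  have := congrFun h k
  simpa [signVector, hk] using this

lemma exists_pos_signVector_eq {p : ℕ} (u : EuclideanSpace ℝ (Fin p)) :
    ∃ η > 0, ∀ v ∈ rootFlat u, ‖v - u‖ < η → signVector v = signVector u := by
  have h : ∀ᶠ v in 𝓝 u, ∀ k, rootForm k u ≠ 0 → 0 < rootForm k u * rootForm k v := by
    refine eventually_all.2 fun k => ?_
    by_cases h0 : rootForm k u = 0
    · simp [h0]
    · have hc : ContinuousAt (fun v => rootForm k u * rootForm k v) u := by fun_prop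
      exact (hc.eventually (lt_mem_nhds (mul_self_pos.2 h0))).mono fun x hx _ => hx
  obtain ⟨η, hη, hball⟩ := Metric.eventually_nhds_iff.1 h
  refine ⟨η, hη, fun v hv hvu => funext fun k => ?_⟩
  simp only [signVector]
  by_cases h0 : rootForm k u = 0
  · rw [h0, hv k h0]
  · have hpos := hball (by rwa [dist_eq_norm]) k h0
    rcases lt_or_gt_of_ne h0 with hneg | hneg
    · rw [sign_neg hneg, sign_neg (neg_of_mul_pos_right hpos hneg.le)]
    · rw [sign_pos hneg, sign_pos (pos_of_mul_pos_right hpos hneg.le)]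

lemma signVector_smul {p : ℕ} {c : ℝ} (hc : 0 < c) (u : EuclideanSpace ℝ (Fin p)) :
    signVector (c • u) = signVector u := by
  funext k
  simp [signVector, sign_mul, sign_pos hc]

lemma signVector_convex {p : ℕ} {u v : EuclideanSpace ℝ (Fin p)}
    (h : signVector u = signVector v) {a b : ℝ} (ha : 0 ≤ a) (hb : 0 ≤ b) (hab : a + b = 1) :
    signVector (a • u + b • v) = signVector u := by
  funext k
  have hk : SignType.sign (rootForm k u) = SignType.sign (rootForm k v) := congrFun h k
  simp only [signVector, map_add, map_smul, smul_eq_mul]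
  rcases lt_trichotomy (rootForm k u) 0 with h0 | h0 | h0
  · have hv : rootForm k v < 0 := by rwa [sign_neg h0, eq_comm, sign_eq_neg_one_iff] at hk
    rw [sign_neg h0]
    refine sign_neg ?_
    rcases ha.eq_or_lt with rfl | ha
    · have : b = 1 := by linarith
      simpa [this] using hv
    · nlinarith [mul_neg_of_pos_of_neg ha h0, mul_nonneg hb (neg_nonneg.2 hv.le)]
  · have hv : rootForm k v = 0 := by rwa [h0, sign_zero, eq_comm, sign_eq_zero_iff] at hk
    simp [h0, hv]
  · have hv : 0 < rootForm k v := by rwa [sign_pos h0, eq_comm, sign_eq_one_iff] at hk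
    rw [sign_pos h0]
    refine sign_pos ?_
    rcases ha.eq_or_lt with rfl | ha
    · have : b = 1 := by linarith
      simpa [this] using hv
    · nlinarith [mul_pos ha h0, mul_nonneg hb hv.le]

/-- A subgradient at one point of a cone is a subgradient at all its points. For small $t$ the
vector $u-tv$ stays in the cone, so $f(u)=f(u-tv)+tf(v)$; as $\langle r,\cdot\rangle\le f$ on both
pieces with equality for the sum, both are equalities. -/
lemma IsSublinearSubgradient.inner_eq {p : ℕ} {lam : Fin p → ℝ}
    {β₀ u v r : EuclideanSpace ℝ (Fin p)}
    (h : IsSublinearSubgradient (slopeDirDeriv lam β₀) u r) (huv : signVector v = signVector u) :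
    inner ℝ r v = slopeDirDeriv lam β₀ v := by
  obtain ⟨η, hη, hball⟩ := exists_pos_signVector_eq u
  obtain ⟨t, ht, hlt⟩ := exists_pos_mul_norm_lt hη ![v]
  have hsign : signVector (u - t • v) = signVector u := by
    refine hball _ ?_ ?_
    · refine Submodule.sub_mem _ (fun _ h => h) (Submodule.smul_mem _ _ ?_)
      exact mem_rootFlat_of_signVector_eq huv
    · simpa [norm_smul, abs_of_pos ht] using hlt 0
  have hadd := slopeDirDeriv_add_of_signVector_eq lam β₀ (u := u - t • v) (v := t • v)
    (by rw [hsign, signVector_smul ht, huv])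
  rw [sub_add_cancel, slopeDirDeriv_smul _ _ _ ht.le] at hadd
  have h1 := h.1 (u - t • v)
  have h2 := h.1 v
  have h3 := h.2
  rw [inner_sub_right, inner_smul_right] at h1
  nlinarith

lemma convex_criticalForms {p : ℕ} {lam : Fin p → ℝ} (hlam : Antitone lam)
    (hlam0 : ∀ i, 0 ≤ lam i) (β₀ : EuclideanSpace ℝ (Fin p))
    (C : EuclideanSpace ℝ (Fin p) →L[ℝ] EuclideanSpace ℝ (Fin p))
    (s : Fin p × Fin p × Bool → SignType) :
    Convex ℝ (criticalForms C (slopeDirDeriv lam β₀) s) := by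
  rintro w₁ ⟨u₁, hs₁, h₁⟩ w₂ ⟨u₂, hs₂, h₂⟩ a b ha hb hab
  refine ⟨a • u₁ + b • u₂, ?_, ?_, ?_⟩
  · rw [signVector_convex (hs₁.trans hs₂.symm) ha hb hab, hs₁]
  all_goals
    have hr : a • w₁ + b • w₂ - C (a • u₁ + b • u₂) = a • (w₁ - C u₁) + b • (w₂ - C u₂) := by
      rw [map_add, map_smul, map_smul]
      module
    rw [hr]
  · intro v
    rw [inner_add_left, real_inner_smul_left, real_inner_smul_left]
    calc _ ≤ a * slopeDirDeriv lam β₀ v + b * slopeDirDeriv lam β₀ v :=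
          add_le_add (mul_le_mul_of_nonneg_left (h₁.1 v) ha)
            (mul_le_mul_of_nonneg_left (h₂.1 v) hb)
      _ = _ := by rw [← add_mul, hab, one_mul]
  · refine le_antisymm ?_ ?_
    · rw [inner_add_left, real_inner_smul_left, real_inner_smul_left]
      calc _ ≤ a * slopeDirDeriv lam β₀ (a • u₁ + b • u₂) +
            b * slopeDirDeriv lam β₀ (a • u₁ + b • u₂) :=
            add_le_add (mul_le_mul_of_nonneg_left (h₁.1 _) ha)
              (mul_le_mul_of_nonneg_left (h₂.1 _) hb)
        _ = _ := by rw [← add_mul, hab, one_mul]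
    · have h12 := h₁.inner_eq (hs₂.trans hs₁.symm)
      have h21 := h₂.inner_eq (hs₁.trans hs₂.symm)
      have hle := slopeDirDeriv_add_le hlam hlam0 β₀ (a • u₁) (b • u₂)
      rw [slopeDirDeriv_smul _ _ _ ha, slopeDirDeriv_smul _ _ _ hb] at hle
      refine hle.trans (le_of_eq ?_)
      simp only [inner_add_left, inner_add_right, real_inner_smul_left, real_inner_smul_right,
        h12, h21, h₁.2, h₂.2]
      linear_combination (-a * slopeDirDeriv lam β₀ u₁ - b * slopeDirDeriv lam β₀ u₂) * hab

lemma half_inner_add {p : ℕ} {A : EuclideanSpace ℝ (Fin p) →L[ℝ] EuclideanSpace ℝ (Fin p)}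
    (hA : A.IsSymmetric) (z d : EuclideanSpace ℝ (Fin p)) :
    1 / 2 * inner ℝ (A (z + d)) (z + d) =
      1 / 2 * inner ℝ (A z) z + inner ℝ (A z) d + 1 / 2 * inner ℝ (A d) d := by
  have h : inner ℝ (A d) z = inner ℝ (A z) d := by
    rw [real_inner_comm]
    exact (hA z d).symm
  rw [map_add, inner_add_left, inner_add_right, inner_add_right, h]
  ring

lemma le_of_forall_le_add_mul {a b K : ℝ} (h : ∀ s, 0 < s → s < 1 → a ≤ b + s * K) : a ≤ b := by
  have hc : Tendsto (fun s : ℝ => b + s * K) (𝓝[>] 0) (𝓝 b) := by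
    have : Tendsto (fun s : ℝ => b + s * K) (𝓝 0) (𝓝 (b + 0 * K)) :=
      (by fun_prop : Continuous fun s : ℝ => b + s * K).tendsto 0
    rw [zero_mul, add_zero] at this
    exact this.mono_left nhdsWithin_le_nhds
  refine ge_of_tendsto hc ?_
  filter_upwards [Ioo_mem_nhdsGT zero_lt_one] with s hs using h s hs.1 hs.2

lemma isSublinearSubgradient_of_isMinOn {p : ℕ} {lam : Fin p → ℝ} (hlam : Antitone lam)
    (hlam0 : ∀ i, 0 ≤ lam i) {β₀ w u : EuclideanSpace ℝ (Fin p)}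
    {C : EuclideanSpace ℝ (Fin p) →L[ℝ] EuclideanSpace ℝ (Fin p)} (hC : C.IsSymmetric)
    (hu : IsMinOn (fun v => 1 / 2 * inner ℝ (C v) v - inner ℝ w v + slopeDirDeriv lam β₀ v)
      Set.univ u) :
    IsSublinearSubgradient (slopeDirDeriv lam β₀) u (w - C u) := by
  rw [isMinOn_univ_iff] at hu
  have hle : ∀ v, inner ℝ (w - C u) v ≤ slopeDirDeriv lam β₀ v := by
    intro v
    refine le_of_forall_le_add_mul (K := 1 / 2 * inner ℝ (C v) v) fun s hs _ => ?_
    have h1 := hu (u + s • v)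
    have h2 := slopeDirDeriv_add_le hlam hlam0 β₀ u (s • v)
    rw [slopeDirDeriv_smul _ _ _ hs.le] at h2
    simp only [half_inner_add hC] at h1
    simp only [map_smul, inner_add_right, real_inner_smul_left,
      real_inner_smul_right] at h1
    rw [inner_sub_left]
    refine le_of_mul_le_mul_left ?_ hs
    nlinarith
  refine ⟨hle, le_antisymm (hle u) ?_⟩
  -- The comparison point is $(1-s)u$, where homogeneity evaluates $f$ exactly; this gives the
  -- reverse inequality as $s\to0$.
  refine le_of_forall_le_add_mul (K := 1 / 2 * inner ℝ (C u) u) fun s hs hs1 => ?_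
  have h1 := hu (u + (-s) • u)
  have h2 : u + (-s) • u = (1 - s) • u := by module
  have h3 := slopeDirDeriv_smul lam β₀ u (sub_nonneg.2 hs1.le)
  rw [← h2] at h3
  simp only [half_inner_add hC] at h1
  simp only [map_smul, inner_add_right, real_inner_smul_left,
    real_inner_smul_right] at h1
  rw [inner_sub_left]
  refine le_of_mul_le_mul_left ?_ hs
  nlinarith

/-- In the interior of `criticalForms`, strict complementarity holds: the subgradient can be moved
in all directions orthogonal to the flat of the critical point. -/
lemma exists_pos_inner_add_le {p : ℕ} {lam : Fin p → ℝ} {β₀ w u : EuclideanSpace ℝ (Fin p)}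
    {C : EuclideanSpace ℝ (Fin p) →L[ℝ] EuclideanSpace ℝ (Fin p)}
    (hCpos : ∀ v, v ≠ 0 → 0 < inner ℝ (C v) v)
    (hu : IsSublinearSubgradient (slopeDirDeriv lam β₀) u (w - C u))
    (hw : w ∈ interior (criticalForms C (slopeDirDeriv lam β₀) (signVector u))) :
    ∃ ε > 0, ∀ h ∈ (rootFlat u)ᗮ, ‖h‖ < ε → ∀ v, inner ℝ (w - C u + h) v ≤
      slopeDirDeriv lam β₀ v := by
  obtain ⟨ε, hε, hball⟩ := Metric.mem_nhds_iff.1 (mem_interior_iff_mem_nhds.1 hw)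
  refine ⟨ε, hε, fun h hh hlt v => ?_⟩
  obtain ⟨u₁, hs, h₁⟩ : w + h ∈ criticalForms C (slopeDirDeriv lam β₀) (signVector u) :=
    hball (by simpa using hlt)
  -- Both subgradients agree with $f$ at $u$ and at $u_1$, so their difference $h-C(u_1-u)$ is
  -- orthogonal to $u_1-u$. So is $h$, and positivity of $C$ forces $u_1=u$.
  have hd : u₁ - u = 0 := by
    by_contra hne
    have h2 := h₁.inner_eq hs.symm
    have h3 := hu.inner_eq hs
    have h4 := h₁.2
    have h5 := hu.2
    have h6 : inner ℝ h (u₁ - u) = 0 :=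
      Submodule.inner_left_of_mem_orthogonal (Submodule.sub_mem _
        (mem_rootFlat_of_signVector_eq hs) (fun _ h => h)) hh
    have h7 := hCpos _ hne
    have h8 : inner ℝ (w + h - C u₁ - (w - C u)) (u₁ - u) = 0 := by
      rw [inner_sub_left, inner_sub_right, inner_sub_right, h2, h3, h4, h5, sub_self]
    have h9 : w + h - C u₁ - (w - C u) = h - C (u₁ - u) := by
      rw [map_sub]; abel
    rw [h9, inner_sub_left, h6] at h8
    linarith
  rw [sub_eq_zero.1 hd] at h₁
  have := h₁.1 v
  rwa [add_sub_right_comm] at this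

/-! ### Stability of the sign vector of the minimizer -/

lemma abs_inner_clm_sub_le {p : ℕ}
    {A C : EuclideanSpace ℝ (Fin p) →L[ℝ] EuclideanSpace ℝ (Fin p)} {δ : ℝ} (h : ‖A - C‖ < δ)
    (x y : EuclideanSpace ℝ (Fin p)) : |inner ℝ (A x - C x) y| ≤ δ * ‖x‖ * ‖y‖ := by
  refine (abs_real_inner_le_norm _ _).trans (mul_le_mul_of_nonneg_right ?_ (norm_nonneg _))
  exact ((A - C).le_opNorm x).trans (mul_le_mul_of_nonneg_right h.le (norm_nonneg _))

/-- The rescaled penalized least squares objective. -/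
noncomputable def localObjective {p : ℕ}
    (A : EuclideanSpace ℝ (Fin p) →L[ℝ] EuclideanSpace ℝ (Fin p)) (lam : Fin p → ℝ)
    (β₀ w : EuclideanSpace ℝ (Fin p)) (t : ℝ) (u : EuclideanSpace ℝ (Fin p)) : ℝ :=
  1 / 2 * inner ℝ (A u) u - inner ℝ w u + t⁻¹ * slopeNorm lam (β₀ + t • u)

lemma localObjective_add_smul_le {p : ℕ} {lam : Fin p → ℝ} (hlam : Antitone lam)
    (hlam0 : ∀ i, 0 ≤ lam i) {A : EuclideanSpace ℝ (Fin p) →L[ℝ] EuclideanSpace ℝ (Fin p)}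
    (hA : A.IsSymmetric) (hA0 : ∀ v, 0 ≤ inner ℝ (A v) v) (β₀ w : EuclideanSpace ℝ (Fin p))
    {t : ℝ} (ht : 0 < t) {u v : EuclideanSpace ℝ (Fin p)}
    (hv : localObjective A lam β₀ w t v ≤ localObjective A lam β₀ w t u) {s : ℝ}
    (hs : 0 ≤ s) (hs1 : s ≤ 1) :
    localObjective A lam β₀ w t (u + s • (v - u)) ≤ localObjective A lam β₀ w t u := by
  set d := v - u with hd
  have hvd : v = u + d := by rw [hd]; abel
  have hJ : slopeNorm lam (β₀ + t • (u + s • d)) ≤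
      (1 - s) * slopeNorm lam (β₀ + t • u) + s * slopeNorm lam (β₀ + t • v) := by
    have : β₀ + t • (u + s • d) = (1 - s) • (β₀ + t • u) + s • (β₀ + t • v) := by
      rw [hvd]; module
    rw [this, ← slopeNorm_smul _ (sub_nonneg.2 hs1), ← slopeNorm_smul _ hs]
    exact slopeNorm_add_le hlam hlam0 _ _
  have hJ' := mul_le_mul_of_nonneg_left hJ (inv_nonneg.2 ht.le)
  have hq := hA0 d
  rw [hvd] at hv hJ'
  simp only [localObjective, half_inner_add hA] at hv ⊢
  simp only [map_smul, inner_add_right, real_inner_smul_left,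
    real_inner_smul_right] at hv ⊢
  have h1 : s * (s * inner ℝ (A d) d) ≤ s * inner ℝ (A d) d :=
    mul_le_mul_of_nonneg_left (mul_le_of_le_one_left hq hs1) hs
  nlinarith [mul_nonneg hs (sub_nonneg.2 hv)]

lemma localObjective_sub {p : ℕ} {lam : Fin p → ℝ} {β₀ : EuclideanSpace ℝ (Fin p)} {ρ : ℝ}
    (hρ : ∀ v : EuclideanSpace ℝ (Fin p), ‖v‖ < ρ → ShareChamber β₀ (β₀ + v))
    {A : EuclideanSpace ℝ (Fin p) →L[ℝ] EuclideanSpace ℝ (Fin p)} (hA : A.IsSymmetric)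
    (w : EuclideanSpace ℝ (Fin p)) {t : ℝ} (ht : 0 < t) {u d : EuclideanSpace ℝ (Fin p)}
    (hu : t * ‖u‖ < ρ) (hud : t * ‖u + d‖ < ρ) :
    localObjective A lam β₀ w t (u + d) - localObjective A lam β₀ w t u =
      inner ℝ (A u) d - inner ℝ w d + 1 / 2 * inner ℝ (A d) d +
        (slopeDirDeriv lam β₀ (u + d) - slopeDirDeriv lam β₀ u) := by
  simp only [localObjective]
  rw [slopeNorm_add_smul hρ lam u ht hu, slopeNorm_add_smul hρ lam (u + d) ht hud,
    half_inner_add hA, inner_add_right]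
  field_simp
  ring

theorem exists_pos_signVector_minimizer_eq {p : ℕ} {lam : Fin p → ℝ}
    {β₀ w u₀ : EuclideanSpace ℝ (Fin p)}
    {C : EuclideanSpace ℝ (Fin p) →L[ℝ] EuclideanSpace ℝ (Fin p)} {c : ℝ} (hc : 0 < c)
    (hCpos : ∀ v, c * ‖v‖ ^ 2 ≤ inner ℝ (C v) v)
    (hsub : IsSublinearSubgradient (slopeDirDeriv lam β₀) u₀ (w - C u₀))
    (hw : w ∈ interior (criticalForms C (slopeDirDeriv lam β₀) (signVector u₀))) :
    ∃ δ > 0, ∀ A : EuclideanSpace ℝ (Fin p) →L[ℝ] EuclideanSpace ℝ (Fin p), A.IsSymmetric →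
      ‖A - C‖ < δ → ∀ w', ‖w' - w‖ < δ → ∀ lam' : Fin p → ℝ, Antitone lam' → (∀ i, 0 ≤ lam' i) →
      ‖lam' - lam‖ < δ → ∀ t, 0 < t → t < δ → ∀ u,
      IsMinOn (localObjective A lam' β₀ w' t) Set.univ u → signVector u = signVector u₀ := by
  obtain ⟨ρ, hρ0, hρ⟩ := exists_pos_shareChamber β₀
  obtain ⟨η₀, hη₀, hsign⟩ := exists_pos_signVector_eq u₀
  obtain ⟨ε, hε, hsharp⟩ := exists_pos_inner_add_le (fun v hv => lt_of_lt_of_le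
    (mul_pos hc (pow_pos (norm_pos_iff.2 hv) 2)) (hCpos v)) hsub hw
  -- Within `η` of $u_0$ the sign vector is constant on the flat, and replacing $Cz$ by $Cu_0$ costs
  -- at most $\varepsilon/4$ per unit length.
  obtain ⟨η, hη, hη1, hηη₀, hηC⟩ : ∃ η > 0, η ≤ 1 ∧ η ≤ η₀ ∧ ‖C‖ * η ≤ ε / 4 := by
    refine ⟨min (min 1 η₀) (ε / 4 / (‖C‖ + 1)), by positivity, (min_le_left _ _).trans
      (min_le_left _ _), (min_le_left _ _).trans (min_le_right _ _), ?_⟩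
    calc _ ≤ (‖C‖ + 1) * (ε / 4 / (‖C‖ + 1)) :=
          mul_le_mul (by linarith) (min_le_right _ _) (by positivity) (by positivity)
      _ = ε / 4 := by field_simp
  -- `δ * M` bounds the total error per unit length: $\|u_0\|+1$ from the operator, $1$ from the
  -- linear form, $p$ from the penalty.
  set M := ‖u₀‖ + 2 + p with hM
  have hMpos : 0 < M := by positivity
  obtain ⟨δ, hδ, hδc, hδε, hδη, hδρ⟩ : ∃ δ > 0, δ ≤ c / 2 ∧ δ * M < ε / 4 ∧ δ * M < c * η / 4 ∧
      δ * M < ρ := by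
    set K := min (ε / 4) (min (c * η / 4) ρ) with hK
    have hKpos : 0 < K := by positivity
    have hlt : min (c / 2) (K / 2 / M) * M < K := by
      calc _ ≤ K / 2 / M * M := mul_le_mul_of_nonneg_right (min_le_right _ _) hMpos.le
        _ = K / 2 := by field_simp
        _ < K := by linarith
    exact ⟨min (c / 2) (K / 2 / M), by positivity, min_le_left _ _,
      hlt.trans_le (min_le_left _ _),
      hlt.trans_le ((min_le_right _ _).trans (min_le_left _ _)),
      hlt.trans_le ((min_le_right _ _).trans (min_le_right _ _))⟩
  refine ⟨δ, hδ, fun A hA hAC w' hw' lam' hlam' hlam'0 hll t ht htδ u hu => ?_⟩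
  rw [isMinOn_univ_iff] at hu
  have hApos : ∀ v, c / 2 * ‖v‖ ^ 2 ≤ inner ℝ (A v) v := fun v => by
    have h1 := abs_le.1 (abs_inner_clm_sub_le hAC v v)
    rw [inner_sub_left] at h1
    nlinarith [hCpos v, h1.1, mul_le_mul_of_nonneg_right hδc (sq_nonneg ‖v‖)]
  have hnorm : ∀ x : EuclideanSpace ℝ (Fin p), ‖x - u₀‖ ≤ η → ‖x‖ ≤ ‖u₀‖ + 1 := fun x hx => by
    have := norm_le_norm_add_norm_sub' x u₀
    linarith
  have htsmall : ∀ x : EuclideanSpace ℝ (Fin p), ‖x - u₀‖ ≤ η → t * ‖x‖ < ρ := fun x hx => by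
    refine lt_of_le_of_lt ?_ hδρ
    refine mul_le_mul htδ.le ((hnorm x hx).trans ?_) (norm_nonneg _) hδ.le
    have : (0 : ℝ) ≤ p := Nat.cast_nonneg p
    linarith
  have hlip : ∀ x d : EuclideanSpace ℝ (Fin p),
      slopeDirDeriv lam β₀ (x + d) - slopeDirDeriv lam β₀ x - p * δ * ‖d‖ ≤
      slopeDirDeriv lam' β₀ (x + d) - slopeDirDeriv lam' β₀ x := fun x d => by
    have h1 := (abs_le.1 (abs_slopeDirDeriv_sub_le lam lam' β₀ (x + d) x)).1
    rw [add_sub_cancel_left] at h1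
    have h2 : p * ‖lam' - lam‖ * ‖d‖ ≤ p * δ * ‖d‖ :=
      mul_le_mul_of_nonneg_right (mul_le_mul_of_nonneg_left hll.le (Nat.cast_nonneg p))
        (norm_nonneg _)
    linarith
  have hww : ∀ d, |inner ℝ (w' - w) d| ≤ δ * ‖d‖ := fun d =>
    (abs_real_inner_le_norm _ _).trans (mul_le_mul_of_nonneg_right hw'.le (norm_nonneg _))
  -- the minimizer is close to `u₀`
  have hclose : ‖u - u₀‖ < η := by
    -- By convexity the point at distance exactly `η` on the segment from $u_0$ to $u$ is no worse
    -- than $u_0$. There the exact expansion applies, and the quadratic gain $c\eta^2/4$ exceeds the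
    -- error $\delta M\eta$.
    by_contra! hge
    have hpos : 0 < ‖u - u₀‖ := hη.trans_le hge
    set s := η / ‖u - u₀‖ with hs
    have hs0 : 0 ≤ s := by positivity
    have hs1 : s ≤ 1 := (div_le_one hpos).2 hge
    have hdn : ‖s • (u - u₀)‖ = η := by
      rw [norm_smul, Real.norm_of_nonneg hs0, hs, div_mul_cancel₀ _ hpos.ne']
    have hle := localObjective_add_smul_le hlam' hlam'0 hA (fun v => le_trans (by positivity)
      (hApos v)) β₀ w' ht (hu u₀) hs0 hs1
    set d := s • (u - u₀) with hd
    have hdiff := localObjective_sub (lam := lam') hρ hA w' ht (htsmall u₀ (by simp [hη.le]))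
      (htsmall (u₀ + d) (by simp [hdn]))
    have h1 := hlip u₀ d
    have h2 := hsub.1 (u₀ + d)
    have h3 := hsub.2
    have h4 := (abs_le.1 (abs_inner_clm_sub_le hAC u₀ d)).1
    have h5 := (abs_le.1 (hww d)).2
    have h6 := hApos d
    rw [inner_add_right] at h2
    rw [inner_sub_left] at h2 h3 h4 h5
    rw [inner_sub_left] at h2
    rw [hdn] at h1 h4 h5 h6
    have h7 : δ * M * η < c * η / 4 * η := mul_lt_mul_of_pos_right hδη hη
    rw [hM] at h7
    nlinarith
  -- projection to the flat of `u₀`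
  set z := (rootFlat u₀).starProjection u with hz
  have hzmem : z ∈ rootFlat u₀ := Submodule.starProjection_apply_mem _ _
  have hu₀mem : u₀ ∈ rootFlat u₀ := fun _ h => h
  have hzclose : ‖z - u₀‖ ≤ ‖u - u₀‖ := by
    have h1 : (rootFlat u₀).starProjection (u - u₀) = z - u₀ := by
      rw [map_sub, Submodule.starProjection_eq_self_iff.2 hu₀mem]
    rw [← h1]
    exact Submodule.norm_starProjection_apply_le _ _
  have hzsign : signVector z = signVector u₀ :=
    hsign z hzmem ((hzclose.trans_lt hclose).trans_le hηη₀)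
  have hvperp : u - z ∈ (rootFlat u₀)ᗮ := Submodule.sub_starProjection_mem_orthogonal _
  set v := u - z with hv
  have huzv : u = z + v := by rw [hv]; abel
  suffices hv0 : v = 0 by rw [huzv, hv0, add_zero, hzsign]
  by_contra hne
  have hvpos : 0 < ‖v‖ := norm_pos_iff.2 hne
  have hdiff := localObjective_sub (lam := lam') hρ hA w' ht
    (htsmall z (hzclose.trans hclose.le)) (htsmall (z + v) (by rw [← huzv]; exact hclose.le))
  have hmin := hu z
  rw [huzv] at hmin
  -- Tilting the subgradient along $v$ gives $f(z+v)\ge f(z)+\langle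
  -- w-Cu_0,v\rangle+\frac{\varepsilon}{2}\|v\|$. The errors use up less than this gain, so $z$
  -- would beat $u$.
  set h := (ε / 2 / ‖v‖) • v with hh
  have hhmem : h ∈ (rootFlat u₀)ᗮ := Submodule.smul_mem _ _ hvperp
  have hhn : ‖h‖ = ε / 2 := by
    rw [hh, norm_smul, Real.norm_of_nonneg (by positivity), div_mul_cancel₀ _ hvpos.ne']
  have h1 := hsharp h hhmem (by linarith) (z + v)
  have h2 : inner ℝ h z = 0 := Submodule.inner_left_of_mem_orthogonal hzmem hhmem
  have h3 : inner ℝ h v = ε / 2 * ‖v‖ := by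
    rw [hh, real_inner_smul_left, real_inner_self_eq_norm_sq]
    field_simp
  have h4 := hsub.inner_eq hzsign
  have h5 := hlip z v
  have h6 := (abs_le.1 (abs_inner_clm_sub_le hAC z v)).1
  have h7 := (abs_le.1 (hww v)).2
  have h8 := hApos v
  have h9 : |inner ℝ (C (z - u₀)) v| ≤ ε / 4 * ‖v‖ := by
    refine (abs_real_inner_le_norm _ _).trans (mul_le_mul_of_nonneg_right ?_ (norm_nonneg _))
    exact (C.le_opNorm _).trans ((mul_le_mul_of_nonneg_left (hzclose.trans hclose.le)
      (norm_nonneg _)).trans hηC)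
  have h10 := (abs_le.1 h9).1
  rw [inner_add_left, inner_add_right, inner_add_right, h2, h3, h4] at h1
  rw [map_sub] at h10
  rw [inner_sub_left] at h1 h6 h7 h10
  have h11 : δ * ‖z‖ * ‖v‖ + δ * ‖v‖ + p * δ * ‖v‖ ≤ δ * M * ‖v‖ := by
    have := hnorm z (hzclose.trans hclose.le)
    have h12 : δ * ‖z‖ * ‖v‖ ≤ δ * (‖u₀‖ + 1) * ‖v‖ := by gcongr
    rw [hM]
    linarith
  have h12 : δ * M * ‖v‖ < ε / 4 * ‖v‖ := mul_lt_mul_of_pos_right hδε hvpos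
  have h13 : 0 ≤ c / 2 * ‖v‖ ^ 2 := by positivity
  linarith

/-! ### Nondegenerate Gaussian measures are absolutely continuous -/

lemma pi_absolutelyContinuous {n : ℕ} {μ ν : Fin n → Measure ℝ} [∀ i, SigmaFinite (μ i)]
    [∀ i, SigmaFinite (ν i)] (h : ∀ i, μ i ≪ ν i) : Measure.pi μ ≪ Measure.pi ν := by
  induction n with
  | zero => rw [Measure.pi_of_empty μ, Measure.pi_of_empty ν]
  | succ n ih =>
    rw [← (measurePreserving_piFinSuccAbove μ 0).symm.map_eq,
      ← (measurePreserving_piFinSuccAbove ν 0).symm.map_eq]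
    exact ((h 0).prod (ih fun i => h _)).map (MeasurableEquiv.measurable _)

lemma stdGaussian_absolutelyContinuous {p : ℕ} :
    stdGaussian (EuclideanSpace ℝ (Fin p)) ≪ volume := by
  rw [← map_pi_eq_stdGaussian, ← (PiLp.volume_preserving_toLp (Fin p)).map_eq]
  exact (pi_absolutelyContinuous fun _ => gaussianReal_absolutelyContinuous 0 one_ne_zero).map
    (PiLp.volume_preserving_toLp (Fin p)).measurable

-- The measure is the image of the standard Gaussian under $S^{1/2}$, which is injective and so
-- preserves null sets under preimage.
open scoped MatrixOrder Matrix.Norms.L2Operator in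
lemma multivariateGaussian_absolutelyContinuous {p : ℕ} {S : Matrix (Fin p) (Fin p) ℝ}
    (hS : S.PosDef) : multivariateGaussian 0 S ≪ volume := by
  set B := Matrix.toEuclideanCLM (𝕜 := ℝ) (CFC.sqrt S) with hB
  have hinj : Function.Injective B := by
    refine (injective_iff_map_eq_zero B).2 fun x hx => ?_
    by_contra hne
    have h1 : Matrix.toEuclideanCLM (𝕜 := ℝ) S x = 0 := by
      rw [← CFC.sqrt_mul_sqrt_self S hS.posSemidef.nonneg, map_mul, mul_apply_eq_comp,
        ← hB, hx, map_zero]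
    have h2 := hS.dotProduct_mulVec_pos (x := x.ofLp) (by simpa using hne)
    rw [← Matrix.ofLp_toEuclideanCLM, h1] at h2
    simp at h2
  have hdet : LinearMap.det (B : EuclideanSpace ℝ (Fin p) →ₗ[ℝ] EuclideanSpace ℝ (Fin p)) ≠ 0 :=
    ((LinearMap.isUnit_iff_ker_eq_bot _).2 (LinearMap.ker_eq_bot.2 hinj)).map LinearMap.det |>.ne_zero
  have hq := Measure.LinearMap.quasiMeasurePreserving (volume : Measure (EuclideanSpace ℝ (Fin p))) _ hdet
  rw [multivariateGaussian]
  simp only [zero_add]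
  exact (stdGaussian_absolutelyContinuous.map hq.measurable).trans hq.absolutelyContinuous

/-! ### Independence of pairs -/

/-- Measurable rectangles form a generating π-system, and on them the joint probability factors in
both directions. -/
lemma iIndepFun.prodMk_of_indepFun {Ω β γ : Type*} [MeasurableSpace Ω] [MeasurableSpace β]
    [MeasurableSpace γ] {μ : Measure Ω} {X : ℕ → Ω → β} {Y : ℕ → Ω → γ}
    (hXm : ∀ i, Measurable (X i)) (hYm : ∀ i, Measurable (Y i))
    (hX : iIndepFun X μ) (hY : iIndepFun Y μ)
    (hXY : IndepFun (fun ω i => X i ω) (fun ω i => Y i ω) μ) :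
    iIndepFun (fun i ω => (X i ω, Y i ω)) μ := by
  have hXYi : ∀ i, IndepFun (X i) (Y i) μ := fun i =>
    hXY.comp (measurable_pi_apply i) (measurable_pi_apply i)
  rw [iIndepFun_iff_iIndep]
  set R : Set (Set (β × γ)) := Set.image2 (· ×ˢ ·) {s | MeasurableSet s} {t | MeasurableSet t}
  refine iIndepSets.iIndep (fun i => ((hXm i).prodMk (hYm i)).comap_le)
    (fun i => {s | ∃ t ∈ R, (fun ω => (X i ω, Y i ω)) ⁻¹' t = s})
    (fun i => isPiSystem_prod.comap _) (fun i => ?_) ?_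
  · rw [← generateFrom_prod, MeasurableSpace.comap_generateFrom]
    rfl
  · rw [iIndepSets_iff]
    intro S f hf
    choose! r hr hrf using hf
    choose! s hs t ht hst using hr
    have hfi : ∀ i ∈ S, f i = X i ⁻¹' s i ∩ Y i ⁻¹' t i := fun i hi => by
      rw [← hrf i hi, ← hst i hi]
      rfl
    have hμf : ∀ i ∈ S, μ (f i) = μ (X i ⁻¹' s i) * μ (Y i ⁻¹' t i) := fun i hi => by
      rw [hfi i hi]
      exact (hXYi i).measure_inter_preimage_eq_mul _ _ (hs i hi) (ht i hi)
    have hcap : ⋂ i ∈ S, f i = (fun ω i => X i ω) ⁻¹' (⋂ i ∈ S, Function.eval i ⁻¹' s i) ∩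
        (fun ω i => Y i ω) ⁻¹' (⋂ i ∈ S, Function.eval i ⁻¹' t i) := by
      rw [Set.iInter₂_congr hfi]
      ext ω
      simp only [Set.mem_iInter, Set.mem_inter_iff, Set.mem_preimage, Function.eval]
      exact ⟨fun h => ⟨fun i hi => (h i hi).1, fun i hi => (h i hi).2⟩,
        fun h i hi => ⟨h.1 i hi, h.2 i hi⟩⟩
    rw [hcap, hXY.measure_inter_preimage_eq_mul _ _
      (Finset.measurableSet_biInter _ fun i hi => measurable_pi_apply i (hs i hi))
      (Finset.measurableSet_biInter _ fun i hi => measurable_pi_apply i (ht i hi)),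
      Finset.prod_congr rfl hμf, Finset.prod_mul_distrib,
      ← hX.measure_inter_preimage_eq_mul S hs, ← hY.measure_inter_preimage_eq_mul S ht]
    simp only [Set.preimage_iInter]
    rfl

/-! ### The multivariate central limit theorem -/

/-- Cramér–Wold: the characteristic function at $t$ is that of the projection on $t$ at $1$, to
which the scalar theorem applies. -/
theorem tendsto_map_inv_sqrt_smul_sum {p : ℕ} {Ω : Type*} [MeasurableSpace Ω] {μ : Measure Ω}
    [IsProbabilityMeasure μ] {ξ : ℕ → Ω → EuclideanSpace ℝ (Fin p)} (hm : ∀ i, Measurable (ξ i))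
    (hindep : iIndepFun ξ μ) (hident : ∀ i, IdentDistrib (ξ i) (ξ 0) μ μ)
    {S : Matrix (Fin p) (Fin p) ℝ} (hS : S.PosSemidef)
    (hL2 : ∀ t, MemLp (fun ω => inner ℝ (ξ 0 ω) t) 2 μ)
    (hmean : ∀ t, ∫ ω, inner ℝ (ξ 0 ω) t ∂μ = 0)
    (hvar : ∀ t : EuclideanSpace ℝ (Fin p), ∫ ω, inner ℝ (ξ 0 ω) t ^ 2 ∂μ = t ⬝ᵥ S *ᵥ t) :
    TendstoInDistribution (fun (n : ℕ) ω => (√n)⁻¹ • ∑ i ∈ Finset.range n, ξ i ω) atTop id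
      (fun _ => μ) (multivariateGaussian 0 S) := by
  have hmeas : ∀ n : ℕ, AEMeasurable (fun ω => (√n)⁻¹ • ∑ i ∈ Finset.range n, ξ i ω) μ :=
    fun n => by fun_prop
  refine ⟨hmeas, aemeasurable_id, ProbabilityMeasure.tendsto_iff_tendsto_charFun.2 fun t => ?_⟩
  have hv : Var[fun ω => inner ℝ (ξ 0 ω) t; μ] = t ⬝ᵥ S *ᵥ t := by
    rw [variance_of_integral_eq_zero (hL2 t).1.aemeasurable (hmean t), hvar]
  have hv0 : 0 ≤ (t ⬝ᵥ S *ᵥ t : ℝ) := hv ▸ variance_nonneg _ _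
  have hclt := tendstoInDistribution_inv_sqrt_mul_sum_sub
    (X := fun i ω => inner ℝ (ξ i ω) t) (P := μ) (Y := id)
    (P' := gaussianReal 0 Var[fun ω => inner ℝ (ξ 0 ω) t; μ].toNNReal) HasLaw.id (hL2 t)
    (hindep.comp (fun _ x => inner ℝ x t) fun _ => by fun_prop)
    (fun i => (hident i).comp (u := fun x => inner ℝ x t) (by fun_prop))
  have hchar := (ProbabilityMeasure.tendsto_iff_tendsto_charFun.1 hclt.tendsto) 1
  simp only [hmean t, mul_zero, sub_zero, ProbabilityMeasure.coe_mk, Measure.map_id] at hchar ⊢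
  rw [charFun_gaussianReal, hv] at hchar
  rw [charFun_multivariateGaussian hS]
  convert hchar using 2 with n
  · rw [charFun_apply, charFun_apply, integral_map (hmeas n) (by fun_prop),
      integral_map (hclt.forall_aemeasurable n |>.congr (by simp [hmean t])) (by fun_prop)]
    simp [sum_inner, real_inner_smul_left]
  · simp [Real.coe_toNNReal _ hv0]

/-! ### Second moments of the regressors -/

section Moments

variable {p : ℕ} {Ω : Type*} [MeasurableSpace Ω] {μ : Measure Ω}
  {x : Ω → EuclideanSpace ℝ (Fin p)} {C : Matrix (Fin p) (Fin p) ℝ}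

lemma continuous_rankOne_self :
    Continuous fun y : EuclideanSpace ℝ (Fin p) => InnerProductSpace.rankOne ℝ y y := by
  have h : Continuous fun y : EuclideanSpace ℝ (Fin p) => ContinuousLinearMap.smulRightL ℝ
      (EuclideanSpace ℝ (Fin p)) (EuclideanSpace ℝ (Fin p)) (innerSL ℝ y) y := by fun_prop
  exact h

lemma integrable_rankOne (hx : MemLp x 2 μ) :
    Integrable (fun ω => InnerProductSpace.rankOne ℝ (x ω) (x ω)) μ := by
  have hm : AEStronglyMeasurable (fun ω => InnerProductSpace.rankOne ℝ (x ω) (x ω)) μ :=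
    continuous_rankOne_self.comp_aestronglyMeasurable hx.1
  refine ((memLp_two_iff_integrable_sq_norm hx.1).1 hx).mono hm (Eventually.of_forall fun ω => ?_)
  simp [sq]

lemma integral_rankOne [IsProbabilityMeasure μ] (hx : MemLp x 2 μ) (hmean : ∫ ω, x ω ∂μ = 0)
    (hcov : ∀ j k, covariance (fun ω => x ω j) (fun ω => x ω k) μ = C j k) :
    ∫ ω, InnerProductSpace.rankOne ℝ (x ω) (x ω) ∂μ = Matrix.toEuclideanCLM (𝕜 := ℝ) C := by
  have hmean' : ∀ j, ∫ ω, x ω j ∂μ = 0 := fun j => by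
    have := (EuclideanSpace.proj (𝕜 := ℝ) j : EuclideanSpace ℝ (Fin p) →L[ℝ] ℝ).integral_comp_comm
      (hx.integrable one_le_two)
    simpa [hmean] using this
  have hmem : ∀ j, MemLp (fun ω => x ω j) 2 μ := fun j =>
    (EuclideanSpace.proj (𝕜 := ℝ) j : EuclideanSpace ℝ (Fin p) →L[ℝ] ℝ).comp_memLp' hx
  have hentry : ∀ j k, ∫ ω, x ω k * x ω j ∂μ = C k j := fun j k => by
    rw [← hcov, covariance_eq_sub (hmem k) (hmem j), hmean', zero_mul, sub_zero]
    rfl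
  refine ContinuousLinearMap.coe_injective
    ((EuclideanSpace.basisFun (Fin p) ℝ).toBasis.ext fun j => ?_)
  ext k
  have h1 := (((EuclideanSpace.proj (𝕜 := ℝ) k : EuclideanSpace ℝ (Fin p) →L[ℝ] ℝ).comp
    (ContinuousLinearMap.apply ℝ (EuclideanSpace ℝ (Fin p))
      (EuclideanSpace.single j (1 : ℝ))))).integral_comp_comm (integrable_rankOne hx)
  simp only [ContinuousLinearMap.comp_apply, ContinuousLinearMap.apply_apply,
    InnerProductSpace.rankOne_apply, PiLp.proj_apply] at h1
  simp only [OrthonormalBasis.coe_toBasis, EuclideanSpace.basisFun_apply,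
    ContinuousLinearMap.coe_coe]
  rw [← h1]
  simp [Matrix.ofLp_toEuclideanCLM, EuclideanSpace.inner_single_right, ← hentry, mul_comm]

lemma integral_inner_sq [IsProbabilityMeasure μ] (hx : MemLp x 2 μ) (hmean : ∫ ω, x ω ∂μ = 0)
    (hcov : ∀ j k, covariance (fun ω => x ω j) (fun ω => x ω k) μ = C j k)
    (t : EuclideanSpace ℝ (Fin p)) : ∫ ω, inner ℝ (x ω) t ^ 2 ∂μ = t ⬝ᵥ C *ᵥ t := by
  have h1 := ((innerSL ℝ t).comp
    (ContinuousLinearMap.apply ℝ (EuclideanSpace ℝ (Fin p)) t)).integral_comp_comm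
      (integrable_rankOne hx)
  rw [integral_rankOne hx hmean hcov] at h1
  simp only [ContinuousLinearMap.comp_apply, ContinuousLinearMap.apply_apply,
    InnerProductSpace.rankOne_apply, innerSL_apply_apply, Matrix.inner_toEuclideanCLM] at h1
  rw [← h1]
  refine integral_congr_ae (Eventually.of_forall fun ω => ?_)
  simp only [real_inner_smul_right, real_inner_comm t (x ω), sq]

end Moments

/-! ### The rescaled estimation problem -/

/-- The normalized Gram operator of the first `n` regressors. -/
noncomputable def gramOperator {p : ℕ} (n : ℕ) (x : ℕ → EuclideanSpace ℝ (Fin p)) :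
    EuclideanSpace ℝ (Fin p) →L[ℝ] EuclideanSpace ℝ (Fin p) :=
  (n : ℝ)⁻¹ • ∑ i ∈ Finset.range n, InnerProductSpace.rankOne ℝ (x i) (x i)

/-- The normalized score vector `n^(-1/2) ∑ e_i x_i`. -/
noncomputable def scoreVector {p : ℕ} (n : ℕ) (x : ℕ → EuclideanSpace ℝ (Fin p)) (e : ℕ → ℝ) :
    EuclideanSpace ℝ (Fin p) :=
  (√(n : ℝ))⁻¹ • ∑ i ∈ Finset.range n, e i • x i

lemma inner_gramOperator {p : ℕ} (n : ℕ) (x : ℕ → EuclideanSpace ℝ (Fin p))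
    (u v : EuclideanSpace ℝ (Fin p)) : inner ℝ (gramOperator n x u) v =
      (n : ℝ)⁻¹ * ∑ i ∈ Finset.range n, inner ℝ (x i) u * inner ℝ (x i) v := by
  simp [gramOperator, real_inner_smul_left, sum_inner]

lemma gramOperator_isSymmetric {p : ℕ} (n : ℕ) (x : ℕ → EuclideanSpace ℝ (Fin p)) :
    (gramOperator n x).IsSymmetric := by
  intro u v
  change inner ℝ (gramOperator n x u) v = inner ℝ u (gramOperator n x v)
  rw [real_inner_comm (gramOperator n x v) u]
  simp only [inner_gramOperator, mul_comm]

lemma response_sub_apply {p : ℕ} (n : ℕ) (x : ℕ → EuclideanSpace ℝ (Fin p)) (e : ℕ → ℝ)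
    (β₀ u : EuclideanSpace ℝ (Fin p)) (t : ℝ) (i : Fin n) :
    (response n x e β₀ - designMatrix n x *ᵥ (β₀ + t • u).ofLp) i =
      e i - t * inner ℝ (x i) u := by
  have h : (designMatrix n x *ᵥ u.ofLp) i = inner ℝ (x i) u := by
    simp [designMatrix, Matrix.mulVec, dotProduct, PiLp.inner_apply, mul_comm]
  simp only [response, WithLp.ofLp_add, WithLp.ofLp_smul, Matrix.mulVec_add, Matrix.mulVec_smul,
    Pi.sub_apply, Pi.add_apply, Pi.smul_apply, h, smul_eq_mul]
  ring

lemma half_norm_sq_residual {p n : ℕ} (hn : 1 ≤ n) (x : ℕ → EuclideanSpace ℝ (Fin p)) (e : ℕ → ℝ)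
    (β₀ u : EuclideanSpace ℝ (Fin p)) :
    1 / 2 * ‖WithLp.toLp 2 (response n x e β₀ -
        designMatrix n x *ᵥ (β₀ + (√(n : ℝ))⁻¹ • u).ofLp)‖ ^ 2 =
      1 / 2 * ∑ i ∈ Finset.range n, e i ^ 2 +
        (1 / 2 * inner ℝ (gramOperator n x u) u - inner ℝ (scoreVector n x e) u) := by
  have hn0 : (0 : ℝ) < n := by exact_mod_cast hn
  have ht : (√(n : ℝ))⁻¹ ^ 2 = (n : ℝ)⁻¹ := by rw [inv_pow, Real.sq_sqrt hn0.le]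
  rw [EuclideanSpace.real_norm_sq_eq]
  simp only [response_sub_apply]
  rw [Fin.sum_univ_eq_sum_range (fun i => (e i - (√(n : ℝ))⁻¹ * inner ℝ (x i) u) ^ 2) n,
    inner_gramOperator, ← ht, scoreVector, real_inner_smul_left, sum_inner]
  simp only [Finset.mul_sum]
  rw [← Finset.sum_sub_distrib, ← Finset.sum_add_distrib]
  refine Finset.sum_congr rfl fun i _ => ?_
  rw [real_inner_smul_left]
  ring

lemma isMinOn_localObjective_of_isSlopeEstimate {p n : ℕ} (hn : 1 ≤ n)
    {x : ℕ → EuclideanSpace ℝ (Fin p)} {e : ℕ → ℝ} {β₀ β : EuclideanSpace ℝ (Fin p)}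
    {lam : Fin p → ℝ}
    (h : IsSlopeEstimate (designMatrix n x) (response n x e β₀) lam β) :
    IsMinOn (localObjective (gramOperator n x) (fun i => lam i / √(n : ℝ)) β₀ (scoreVector n x e)
      (√(n : ℝ))⁻¹) Set.univ (√(n : ℝ) • (β - β₀)) := by
  have hn0 : 0 < √(n : ℝ) := Real.sqrt_pos.2 (by exact_mod_cast hn)
  have hlam : (fun i => lam i / √(n : ℝ)) = (√(n : ℝ))⁻¹ • lam := by
    funext i
    simp [div_eq_inv_mul]
  have key : ∀ u, 1 / 2 * ‖WithLp.toLp 2 (response n x e β₀ -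
      designMatrix n x *ᵥ (β₀ + (√(n : ℝ))⁻¹ • u).ofLp)‖ ^ 2 +
      slopeNorm lam (β₀ + (√(n : ℝ))⁻¹ • u) = 1 / 2 * ∑ i ∈ Finset.range n, e i ^ 2 +
      localObjective (gramOperator n x) (fun i => lam i / √(n : ℝ)) β₀ (scoreVector n x e)
        (√(n : ℝ))⁻¹ u := fun u => by
    rw [half_norm_sq_residual hn, localObjective, hlam, slopeNorm_lam_smul,
      inv_inv, mul_inv_cancel_left₀ hn0.ne']
    ring
  rw [isMinOn_univ_iff]
  intro u
  rw [IsSlopeEstimate, isMinOn_univ_iff] at h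
  have h1 := h (β₀ + (√(n : ℝ))⁻¹ • u)
  have h2 : β = β₀ + (√(n : ℝ))⁻¹ • (√(n : ℝ) • (β - β₀)) := by
    rw [inv_smul_smul₀ hn0.ne']
    abel
  rw [key u] at h1
  nth_rewrite 1 2 [h2] at h1
  rw [key] at h1
  linarith

/-! ### Limit theorems for the Gram operator and the score vector -/

section Limits

variable {p : ℕ} {Ω : Type*} [MeasurableSpace Ω] {μ : Measure Ω} [IsProbabilityMeasure μ]
  {X : ℕ → Ω → EuclideanSpace ℝ (Fin p)} {C : Matrix (Fin p) (Fin p) ℝ}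

lemma measurable_gramOperator (hX_meas : ∀ i, Measurable (X i)) (n : ℕ) :
    Measurable fun ω => gramOperator n fun i => X i ω := by
  have : ∀ i, Measurable fun ω => InnerProductSpace.rankOne ℝ (X i ω) (X i ω) := fun i =>
    continuous_rankOne_self.measurable.comp (hX_meas i)
  unfold gramOperator
  fun_prop

lemma tendsto_measure_le_norm_gramOperator_sub (hX_meas : ∀ i, Measurable (X i))
    (hX_indep : iIndepFun X μ) (hX_ident : ∀ i, IdentDistrib (X i) (X 0) μ μ)
    (hX_memLp : MemLp (X 0) 2 μ) (hX_mean : ∫ ω, X 0 ω ∂μ = 0)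
    (hX_cov : ∀ j k, covariance (fun ω => X 0 ω j) (fun ω => X 0 ω k) μ = C j k)
    {δ : ℝ} (hδ : 0 < δ) :
    Tendsto (fun n => μ {ω | δ ≤ ‖gramOperator n (fun i => X i ω) -
      Matrix.toEuclideanCLM (𝕜 := ℝ) C‖}) atTop (𝓝 0) := by
  have hg : Measurable fun y : EuclideanSpace ℝ (Fin p) => InnerProductSpace.rankOne ℝ y y :=
    continuous_rankOne_self.measurable
  have hslln := strong_law_ae (μ := μ)
    (fun i ω => InnerProductSpace.rankOne ℝ (X i ω) (X i ω)) (integrable_rankOne hX_memLp)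
    (fun i j hij => (hX_indep.indepFun hij).comp hg hg) (fun i => (hX_ident i).comp hg)
  rw [integral_rankOne hX_memLp hX_mean hX_cov] at hslln
  have h := tendstoInMeasure_of_tendsto_ae
    (fun n => (measurable_gramOperator hX_meas n).aestronglyMeasurable) hslln
  exact tendstoInMeasure_iff_norm.1 h δ hδ

lemma tendstoInDistribution_scoreVector (hX_meas : ∀ i, Measurable (X i))
    (hX_indep : iIndepFun X μ) (hX_ident : ∀ i, IdentDistrib (X i) (X 0) μ μ)
    (hX_memLp : MemLp (X 0) 2 μ) (hX_mean : ∫ ω, X 0 ω ∂μ = 0)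
    (hX_cov : ∀ j k, covariance (fun ω => X 0 ω j) (fun ω => X 0 ω k) μ = C j k)
    (hC : C.PosSemidef) {ε : ℕ → Ω → ℝ} {σ : ℝ} (hε_meas : ∀ i, Measurable (ε i))
    (hε_indep : iIndepFun ε μ) (hε_ident : ∀ i, IdentDistrib (ε i) (ε 0) μ μ)
    (hε_memLp : MemLp (ε 0) 2 μ) (hε_mean : ∫ ω, ε 0 ω ∂μ = 0)
    (hε_var : variance (ε 0) μ = σ ^ 2)
    (hXε_indep : IndepFun (fun ω i => X i ω) (fun ω i => ε i ω) μ) :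
    TendstoInDistribution (fun n ω => scoreVector n (fun i => X i ω) (fun i => ε i ω)) atTop id
      (fun _ => μ) (multivariateGaussian 0 (σ ^ 2 • C)) := by
  have hg : Measurable fun z : EuclideanSpace ℝ (Fin p) × ℝ => z.2 • z.1 := by fun_prop
  have hind : ∀ i, IndepFun (X i) (ε i) μ := fun i =>
    hXε_indep.comp (measurable_pi_apply i) (measurable_pi_apply i)
  have hpair := iIndepFun.prodMk_of_indepFun hX_meas hε_meas hX_indep hε_indep hXε_indep
  have hinner : ∀ t : EuclideanSpace ℝ (Fin p),
      IndepFun (ε 0) (fun ω => inner ℝ (X 0 ω) t) μ := fun t =>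
    ((hind 0).comp (φ := fun y => inner ℝ y t) (by fun_prop) measurable_id).symm
  have hsq : ∀ t : EuclideanSpace ℝ (Fin p),
      IndepFun (fun ω => ε 0 ω ^ 2) (fun ω => inner ℝ (X 0 ω) t ^ 2) μ := fun t =>
    (hinner t).comp (φ := fun y => y ^ 2) (ψ := fun y => y ^ 2) (by fun_prop) (by fun_prop)
  have hL2 : ∀ t : EuclideanSpace ℝ (Fin p), MemLp (fun ω => inner ℝ (X 0 ω) t) 2 μ := fun t => by
    have := (innerSL ℝ t).comp_memLp' hX_memLp
    simpa [Function.comp_def, real_inner_comm] using this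
  refine tendsto_map_inv_sqrt_smul_sum (ξ := fun i ω => ε i ω • X i ω)
    (fun i => (hε_meas i).smul (hX_meas i)) (hpair.comp (fun _ z => z.2 • z.1) fun _ => hg)
    (fun i => ((hX_ident i).prodMk (hε_ident i) (hind i) (hind 0)).comp hg)
    (hC.smul (sq_nonneg σ)) (fun t => ?_) (fun t => ?_) (fun t => ?_)
  · simp only [real_inner_smul_left]
    refine (memLp_two_iff_integrable_sq ?_).2 ?_
    · exact hε_memLp.1.mul (hL2 t).1
    · simp only [mul_pow]
      exact (hsq t).integrable_mul hε_memLp.integrable_sq (hL2 t).integrable_sq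
  · simp only [real_inner_smul_left]
    rw [(hinner t).integral_fun_mul_eq_mul_integral hε_memLp.1 (hL2 t).1, hε_mean, zero_mul]
  · simp only [real_inner_smul_left, mul_pow]
    rw [(hsq t).integral_fun_mul_eq_mul_integral (hε_memLp.1.pow 2) ((hL2 t).1.pow 2),
      integral_inner_sq hX_memLp hX_mean hX_cov,
      ← variance_of_integral_eq_zero hε_memLp.1.aemeasurable hε_mean, hε_var,
      Matrix.smul_mulVec, dotProduct_smul, smul_eq_mul]

end Limits

/-! ### Regions of stable patterns -/

/-- The forms `w` such that all estimation problems that are `δ`-close to the limit problem with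
linear form `w` have their patterns in `T`. -/
def stableRegion {p : ℕ} (C : EuclideanSpace ℝ (Fin p) →L[ℝ] EuclideanSpace ℝ (Fin p))
    (lam : Fin p → ℝ) (β₀ : EuclideanSpace ℝ (Fin p)) (T : Set (Fin p → ℤ)) (δ : ℝ) :
    Set (EuclideanSpace ℝ (Fin p)) :=
  {w | ∀ A : EuclideanSpace ℝ (Fin p) →L[ℝ] EuclideanSpace ℝ (Fin p), A.IsSymmetric →
      ‖A - C‖ < δ → ∀ w', ‖w' - w‖ < δ → ∀ lam' : Fin p → ℝ, Antitone lam' → (∀ i, 0 ≤ lam' i) →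
      ‖lam' - lam‖ < δ → ∀ t, 0 < t → t < δ → ∀ u,
      IsMinOn (localObjective A lam' β₀ w' t) Set.univ u → slopePattern u ∈ T}

lemma stableRegion_anti {p : ℕ}
    {C : EuclideanSpace ℝ (Fin p) →L[ℝ] EuclideanSpace ℝ (Fin p)}
    {lam : Fin p → ℝ} {β₀ : EuclideanSpace ℝ (Fin p)} {T : Set (Fin p → ℤ)} {δ δ' : ℝ}
    (h : δ ≤ δ') : stableRegion C lam β₀ T δ' ⊆ stableRegion C lam β₀ T δ :=
  fun _ hw A hA hAC w' hw' lam' h1 h2 hl t ht htδ u hu =>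
    hw A hA (hAC.trans_le h) w' (hw'.trans_le h) lam' h1 h2 (hl.trans_le h) t ht (htδ.trans_le h) u hu

lemma mem_interior_stableRegion {p : ℕ}
    {C : EuclideanSpace ℝ (Fin p) →L[ℝ] EuclideanSpace ℝ (Fin p)}
    {lam : Fin p → ℝ} {β₀ w : EuclideanSpace ℝ (Fin p)} {T : Set (Fin p → ℤ)} {δ : ℝ} (hδ : 0 < δ)
    (hw : w ∈ stableRegion C lam β₀ T (2 * δ)) : w ∈ interior (stableRegion C lam β₀ T δ) := by
  refine mem_interior.2 ⟨Metric.ball w δ, fun z hz => ?_, Metric.isOpen_ball,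
    Metric.mem_ball_self hδ⟩
  have hz' : ‖z - w‖ < δ := by simpa [dist_eq_norm] using hz
  intro A hA hAC w' hw' lam' h1 h2 hl t ht htδ u hu
  refine hw A hA (by linarith) w' ?_ lam' h1 h2 (by linarith) t ht (by linarith) u hu
  calc ‖w' - w‖ = ‖(w' - z) + (z - w)‖ := by congr 1; abel
    _ ≤ ‖w' - z‖ + ‖z - w‖ := norm_add_le _ _
    _ < 2 * δ := by linarith

lemma Matrix.PosDef.exists_pos_mul_norm_sq_le {p : ℕ} {C : Matrix (Fin p) (Fin p) ℝ}
    (hC : C.PosDef) : ∃ c > 0, ∀ v : EuclideanSpace ℝ (Fin p),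
      c * ‖v‖ ^ 2 ≤ inner ℝ (Matrix.toEuclideanCLM (𝕜 := ℝ) C v) v := by
  have hpos : ∀ v : EuclideanSpace ℝ (Fin p), v ≠ 0 →
      0 < inner ℝ (Matrix.toEuclideanCLM (𝕜 := ℝ) C v) v := fun v hv => by
    rw [real_inner_comm, Matrix.inner_toEuclideanCLM]
    simpa using hC.dotProduct_mulVec_pos (x := v.ofLp) (by simpa using hv)
  rcases (Metric.sphere (0 : EuclideanSpace ℝ (Fin p)) 1).eq_empty_or_nonempty with he | hne
  · refine ⟨1, one_pos, fun v => ?_⟩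
    have hv : v = 0 := by
      by_contra hv
      have : ‖v‖⁻¹ • v ∈ Metric.sphere (0 : EuclideanSpace ℝ (Fin p)) 1 := by
        simp [norm_smul, norm_ne_zero_iff.2 hv]
      simp [he] at this
    simp [hv]
  · obtain ⟨z, hz, hmin⟩ := (isCompact_sphere (0 : EuclideanSpace ℝ (Fin p)) 1).exists_isMinOn hne
      (f := fun v => inner ℝ (Matrix.toEuclideanCLM (𝕜 := ℝ) C v) v)
      (by fun_prop : Continuous _).continuousOn
    have hz0 : z ≠ 0 := fun h => by simp [h] at hz
    refine ⟨_, hpos z hz0, fun v => ?_⟩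
    rcases eq_or_ne v 0 with rfl | hv
    · simp
    · have hvn : 0 < ‖v‖ := norm_pos_iff.2 hv
      have hmem : ‖v‖⁻¹ • v ∈ Metric.sphere (0 : EuclideanSpace ℝ (Fin p)) 1 := by
        simp [norm_smul, hvn.ne']
      have h := hmin hmem
      simp only [Set.mem_ofPred_eq, map_smul, real_inner_smul_left, real_inner_smul_right] at h
      calc _ ≤ (‖v‖⁻¹ * (‖v‖⁻¹ * inner ℝ (Matrix.toEuclideanCLM (𝕜 := ℝ) C v) v)) * ‖v‖ ^ 2 :=
            mul_le_mul_of_nonneg_right h (sq_nonneg _)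
        _ = _ := by field_simp

lemma toEuclideanCLM_isSymmetric {p : ℕ} {C : Matrix (Fin p) (Fin p) ℝ} (hC : C.IsHermitian) :
    (Matrix.toEuclideanCLM (𝕜 := ℝ) C).IsSymmetric := by
  rw [← ContinuousLinearMap.isSelfAdjoint_iff_isSymmetric]
  exact (show IsSelfAdjoint C from hC).map _

/-- Almost every linear form whose limit problem has its pattern in `T` is a stable one. -/
lemma ae_exists_mem_interior_stableRegion {p : ℕ} {C : Matrix (Fin p) (Fin p) ℝ} (hC : C.PosDef)
    {lam : Fin p → ℝ} (hlam : Antitone lam) (hlam0 : ∀ i, 0 ≤ lam i)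
    (β₀ : EuclideanSpace ℝ (Fin p)) (T : Set (Fin p → ℤ)) :
    ∀ᵐ w : EuclideanSpace ℝ (Fin p), ∀ u, IsMinOn (limitObjective C lam β₀ w) Set.univ u →
      slopePattern u ∈ T → ∃ m : ℕ,
        w ∈ interior (stableRegion (Matrix.toEuclideanCLM (𝕜 := ℝ) C) lam β₀ T (1 / (m + 1))) := by
  obtain ⟨c, hc, hCpos⟩ := hC.exists_pos_mul_norm_sq_le
  set D := Matrix.toEuclideanCLM (𝕜 := ℝ) C with hD
  -- There are finitely many sign vectors, and each set is convex, so one null set covers all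
  -- frontiers.
  have hnull : ∀ᵐ w : EuclideanSpace ℝ (Fin p), ∀ s,
      w ∉ frontier (criticalForms D (slopeDirDeriv lam β₀) s) := by
    refine ae_all_iff.2 fun s => ?_
    exact measure_eq_zero_iff_ae_notMem.1
      ((convex_criticalForms hlam hlam0 β₀ D s).addHaar_frontier volume)
  filter_upwards [hnull] with w hw u hu huT
  have hobj : limitObjective C lam β₀ w =
      fun v => 1 / 2 * inner ℝ (D v) v - inner ℝ w v + slopeDirDeriv lam β₀ v := by
    funext v
    rw [limitObjective, real_inner_comm, hD, Matrix.inner_toEuclideanCLM]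
    simp [EuclideanSpace.inner_eq_star_dotProduct]
  rw [hobj] at hu
  have hsub := isSublinearSubgradient_of_isMinOn hlam hlam0
    (toEuclideanCLM_isSymmetric hC.isHermitian) hu
  have hmem : w ∈ criticalForms D (slopeDirDeriv lam β₀) (signVector u) := ⟨u, rfl, hsub⟩
  have hint : w ∈ interior (criticalForms D (slopeDirDeriv lam β₀) (signVector u)) := by
    by_contra hn
    exact hw (signVector u) ⟨subset_closure hmem, hn⟩
  obtain ⟨δ, hδ, hstable⟩ := exists_pos_signVector_minimizer_eq hc hCpos hsub hint
  obtain ⟨m, hm⟩ := exists_nat_one_div_lt (half_pos hδ)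
  refine ⟨m, mem_interior_stableRegion Nat.one_div_pos_of_nat
    (stableRegion_anti (δ' := δ) (by linarith) ?_)⟩
  intro A hA hAC w' hw' lam' h1 h2 hl t ht htδ v hv
  rwa [slopePattern_eq_of_signVector_eq (hstable A hA hAC w' hw' lam' h1 h2 hl t ht htδ v hv)]

/-! ### Convergence of the pattern probabilities -/

/-- Continuity from below selects one $G_m$ of measure above $c$, the portmanteau inequality
transfers this to $Z_n$, and the slack $c'-c$ absorbs the exceptional event $B_{m,n}$. -/
lemma exists_eventually_lt_measure_inter {E Ω Ω' : Type*} [PseudoEMetricSpace E]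
    [MeasurableSpace E] [BorelSpace E] [MeasurableSpace Ω] [MeasurableSpace Ω'] {μ : Measure Ω}
    [IsProbabilityMeasure μ] {ν : Measure Ω'} {γ : Measure E} [IsProbabilityMeasure γ]
    {Z : ℕ → Ω → E} (hZ : TendstoInDistribution Z atTop id (fun _ => μ) γ) {W : Ω' → E}
    (hW : HasLaw W γ ν) {G : ℕ → Set E} (hG : ∀ m, IsOpen (G m)) (hGmono : Monotone G)
    {B : ℕ → ℕ → Set Ω} (hB : ∀ m, Tendsto (fun n => μ (B m n)) atTop (𝓝 0))
    {S : Set Ω'} (hS : ∀ᵐ ω ∂ν, ω ∈ S → ∃ m, W ω ∈ G m) {c : ENNReal} (hc : c < ν S) :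
    ∃ m, ∀ᶠ n in atTop, c < μ (Z n ⁻¹' G m \ B m n) := by
  have h1 : ν S ≤ γ (⋃ m, G m) := by
    rw [← hW.map_eq, Measure.map_apply_of_aemeasurable hW.aemeasurable
      (MeasurableSet.iUnion fun m => (hG m).measurableSet)]
    refine measure_mono_ae ?_
    filter_upwards [hS] with ω hω hmem
    exact Set.mem_iUnion.2 (hω hmem)
  obtain ⟨m, hm⟩ : ∃ m, c < γ (G m) := by
    by_contra! hle
    refine absurd (hc.trans_le h1) (not_lt.2 ?_)
    rw [hGmono.measure_iUnion]
    exact iSup_le hle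
  obtain ⟨c', hcc', hc'⟩ := exists_between hm
  refine ⟨m, ?_⟩
  have hlim : c' < liminf (fun n => μ.map (Z n) (G m)) atTop := by
    refine hc'.trans_le ?_
    have := ProbabilityMeasure.le_liminf_measure_open_of_tendsto hZ.tendsto (hG m)
    simpa using this
  have hsmall : ∀ᶠ n in atTop, μ (B m n) < c' - c :=
    (hB m).eventually (gt_mem_nhds (tsub_pos_of_lt hcc'))
  filter_upwards [eventually_lt_of_lt_liminf hlim, hsmall] with n hn hn'
  rw [Measure.map_apply_of_aemeasurable (hZ.forall_aemeasurable n) (hG m).measurableSet] at hn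
  by_contra! hle
  have h2 : μ (Z n ⁻¹' G m) ≤ μ (Z n ⁻¹' G m \ B m n) + μ (B m n) :=
    (measure_mono (by rw [Set.sdiff_union_self]; exact Set.subset_union_left)).trans
      (measure_union_le _ _)
  have h3 : c + (c' - c) = c' := add_tsub_cancel_of_le hcc'.le
  have h4 : c + μ (B m n) ≤ c' := h3 ▸ add_le_add_right hn'.le c
  exact absurd (hn.trans_le (h2.trans ((add_le_add_left hle _).trans h4))) (lt_irrefl _)

/-- Lower bounds for all $T$ suffice, since the complement of $\{a\}$ supplies the upper bound. The
measurable inner sets $S$ allow complements although `f n` and `g` need not be measurable. -/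
lemma tendsto_measure_of_forall_lt_inner {ι Ω Ω' : Type*} [MeasurableSpace Ω]
    [MeasurableSpace Ω'] {μ : Measure Ω} [IsProbabilityMeasure μ] {ν : Measure Ω'}
    [IsProbabilityMeasure ν] {f : ℕ → Ω → ι} {g : Ω' → ι}
    (h : ∀ (T : Set ι) (c : ENNReal), c < ν {ω | g ω ∈ T} → ∀ᶠ n in atTop, ∃ S, MeasurableSet S ∧
      c < μ S ∧ ∀ᵐ ω ∂μ, ω ∈ S → f n ω ∈ T) (a : ι) :
    Tendsto (fun n => μ {ω | f n ω = a}) atTop (𝓝 (ν {ω | g ω = a})) := by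
  refine tendsto_order.2 ⟨fun c hc => ?_, fun c hc => ?_⟩
  · filter_upwards [h {a} c hc] with n ⟨S, _, hcS, hS⟩
    refine hcS.trans_le (measure_mono_ae ?_)
    filter_upwards [hS] with ω hω hmem using hω hmem
  · rcases lt_or_ge 1 c with hc1 | hc1
    · exact Eventually.of_forall fun n => prob_le_one.trans_lt hc1
    have hlt : 1 - c < ν {ω | g ω ∈ ({a}ᶜ : Set ι)} := by
      refine ((AddLECancellable.tsub_lt_tsub_iff_left_of_le
        (ENNReal.cancel_of_ne ENNReal.one_ne_top)
        (ENNReal.cancel_of_ne (hc1.trans_lt ENNReal.one_lt_top).ne) hc1).2 hc).trans_le ?_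
      rw [tsub_le_iff_left, ← measure_univ (μ := ν)]
      refine (measure_mono fun ω _ => ?_).trans (measure_union_le _ _)
      by_cases hω : g ω = a
      · exact Or.inl hω
      · exact Or.inr hω
    filter_upwards [h {a}ᶜ (1 - c) hlt] with n ⟨S, hSm, hcS, hS⟩
    have h1 : μ {ω | f n ω = a} ≤ μ Sᶜ := by
      refine measure_mono_ae ?_
      filter_upwards [hS] with ω hω hmem hωS using hω hωS hmem
    rw [prob_compl_eq_one_sub hSm] at h1
    exact h1.trans_lt (ENNReal.sub_lt_of_sub_lt prob_le_one (Or.inl ENNReal.one_ne_top) hcS)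

theorem mainTheorem2 {p : ℕ} {Ω Ω' : Type*} [MeasurableSpace Ω] [MeasurableSpace Ω']
    (μ : Measure Ω) [IsProbabilityMeasure μ] (ν : Measure Ω') [IsProbabilityMeasure ν]
    -- the regressors: i.i.d. centered random vectors with positive definite covariance matrix `C`
    (X : ℕ → Ω → EuclideanSpace ℝ (Fin p)) (C : Matrix (Fin p) (Fin p) ℝ)
    (hX_meas : ∀ i, Measurable (X i))
    (hX_indep : iIndepFun X μ)
    (hX_ident : ∀ i, IdentDistrib (X i) (X 0) μ μ)
    (hX_memLp : MemLp (X 0) 2 μ)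
    (hX_mean : ∫ ω, X 0 ω ∂μ = 0)
    (hX_cov : ∀ j k, covariance (fun ω => X 0 ω j) (fun ω => X 0 ω k) μ = C j k)
    (hC : C.PosDef)
    -- the noise: i.i.d. centered random variables with variance `σ ^ 2`
    (ε : ℕ → Ω → ℝ) (σ : ℝ) (hσ : 0 < σ)
    (hε_meas : ∀ i, Measurable (ε i))
    (hε_indep : iIndepFun ε μ)
    (hε_ident : ∀ i, IdentDistrib (ε i) (ε 0) μ μ)
    (hε_memLp : MemLp (ε 0) 2 μ)
    (hε_mean : ∫ ω, ε 0 ω ∂μ = 0)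
    (hε_var : variance (ε 0) μ = σ ^ 2)
    -- the regressors are independent of the noise
    (hXε_indep : IndepFun (fun ω i => X i ω) (fun ω i => ε i ω) μ)
    -- the penalty sequences and their scaling
    (lamSeq : ℕ → Fin p → ℝ) (lam : Fin p → ℝ)
    (hlam_anti : ∀ n, Antitone (lamSeq n))
    (hlam_nonneg : ∀ n i, 0 ≤ lamSeq n i)
    (hlam_lim : Tendsto (fun n : ℕ => fun i => lamSeq n i / √(n : ℝ)) atTop (𝓝 lam))
    -- the true coefficient vector and the SLOPE estimator with `n` observations
    (β₀ : EuclideanSpace ℝ (Fin p)) (βhat : ℕ → Ω → EuclideanSpace ℝ (Fin p))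
    (hβhat : ∀ n, 1 ≤ n → ∀ᵐ ω ∂μ,
      IsSlopeEstimate (designMatrix n fun i => X i ω)
        (response n (fun i => X i ω) (fun i => ε i ω) β₀) (lamSeq n) (βhat n ω))
    -- the limit: the minimizer of `V` with a centered Gaussian vector `W` of covariance `σ ^ 2 • C`
    (W : Ω' → EuclideanSpace ℝ (Fin p))
    (hW : HasLaw W (multivariateGaussian 0 (σ ^ 2 • C)) ν)
    (uhat : Ω' → EuclideanSpace ℝ (Fin p))
    (huhat : ∀ᵐ ω ∂ν, IsMinOn (limitObjective C lam β₀ (W ω)) Set.univ (uhat ω))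
    (𝔭 : Fin p → ℤ) (h𝔭 : 𝔭 ∈ slopePatterns p) :
    Tendsto (fun n : ℕ => μ {ω | slopePattern (√(n : ℝ) • (βhat n ω - β₀)) = 𝔭}) atTop
      (𝓝 (ν {ω | slopePattern (uhat ω) = 𝔭})) := by
  have hlamA : Antitone lam := fun i j hij =>
    le_of_tendsto_of_tendsto' (tendsto_pi_nhds.1 hlam_lim j) (tendsto_pi_nhds.1 hlam_lim i)
      fun n => div_le_div_of_nonneg_right (hlam_anti n hij) (Real.sqrt_nonneg _)
  have hlam0 : ∀ i, 0 ≤ lam i := fun i =>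
    ge_of_tendsto' (tendsto_pi_nhds.1 hlam_lim i)
      fun n => div_nonneg (hlam_nonneg n i) (Real.sqrt_nonneg _)
  have hS : (σ ^ 2 • C).PosDef := hC.smul (pow_pos hσ 2)
  set D := Matrix.toEuclideanCLM (𝕜 := ℝ) C with hD
  -- The inner event is that the score vector lies in the interior of a stable region while the Gram
  -- operator is close to its limit.
  refine tendsto_measure_of_forall_lt_inner (fun T c hc => ?_) 𝔭
  have hclt := tendstoInDistribution_scoreVector hX_meas hX_indep hX_ident hX_memLp hX_mean hX_cov
    hC.posSemidef hε_meas hε_indep hε_ident hε_memLp hε_mean hε_var hXε_indep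
  have hWae : ∀ᵐ ω ∂ν, ∀ u, IsMinOn (limitObjective C lam β₀ (W ω)) Set.univ u →
      slopePattern u ∈ T → ∃ m : ℕ, W ω ∈ interior (stableRegion D lam β₀ T (1 / (m + 1))) := by
    refine ae_of_ae_map (p := fun w => ∀ u, IsMinOn (limitObjective C lam β₀ w) Set.univ u →
      slopePattern u ∈ T → ∃ m : ℕ, w ∈ interior (stableRegion D lam β₀ T (1 / (m + 1))))
      hW.aemeasurable ?_
    rw [hW.map_eq]
    exact (multivariateGaussian_absolutelyContinuous hS).ae_le
      (ae_exists_mem_interior_stableRegion hC hlamA hlam0 β₀ T)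
  obtain ⟨m, hm⟩ := exists_eventually_lt_measure_inter hclt hW
    (G := fun m : ℕ => interior (stableRegion D lam β₀ T (1 / (m + 1))))
    (fun m => isOpen_interior)
    (fun m m' hmm' => interior_mono (stableRegion_anti (one_div_le_one_div_of_le (by positivity)
      (by gcongr))))
    (B := fun m n => {ω | 1 / ((m : ℝ) + 1) ≤ ‖gramOperator n (fun i => X i ω) - D‖})
    (fun m => tendsto_measure_le_norm_gramOperator_sub hX_meas hX_indep hX_ident hX_memLp hX_mean
      hX_cov Nat.one_div_pos_of_nat)
    (by filter_upwards [hWae, huhat] with ω h1 h2 h3 using h1 _ h2 h3) hc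
  have hδ : (0 : ℝ) < 1 / (m + 1) := Nat.one_div_pos_of_nat
  have hlamn : ∀ᶠ n : ℕ in atTop, ‖(fun i => lamSeq n i / √(n : ℝ)) - lam‖ < 1 / (m + 1) := by
    filter_upwards [hlam_lim.eventually (Metric.ball_mem_nhds lam hδ)] with n hn
    simpa [dist_eq_norm] using hn
  have htn : ∀ᶠ n : ℕ in atTop, (√(n : ℝ))⁻¹ < 1 / (m + 1) :=
    (tendsto_inv_atTop_zero.comp (Real.tendsto_sqrt_atTop.comp
      tendsto_natCast_atTop_atTop)).eventually (gt_mem_nhds hδ)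
  filter_upwards [hm, hlamn, htn, eventually_ge_atTop 1] with n hmn hln htn hn1
  have hgram := measurable_gramOperator hX_meas n
  have hscore : Measurable fun ω => scoreVector n (fun i => X i ω) (fun i => ε i ω) := by
    unfold scoreVector
    fun_prop
  refine ⟨_, (hscore isOpen_interior.measurableSet).diff
    (measurableSet_le measurable_const (hgram.sub_const D).norm), hmn, ?_⟩
  filter_upwards [hβhat n hn1] with ω hω hmem
  exact interior_subset hmem.1 _ (gramOperator_isSymmetric n _) (not_le.1 hmem.2) _
    (by simpa using hδ) _
    (fun i j hij => div_le_div_of_nonneg_right (hlam_anti n hij) (Real.sqrt_nonneg _))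
    (fun i => div_nonneg (hlam_nonneg n i) (Real.sqrt_nonneg _)) hln _
    (inv_pos.2 (Real.sqrt_pos.2 (by exact_mod_cast hn1))) htn _
    (isMinOn_localObjective_of_isSlopeEstimate hn1 hω)
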